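/- Let $n_1,\dots,n_r$ be positive integers with sum $n$ (the block sizes of a standard parabolic subalgebra in type $A_{n-1}$). Let $\mathscr D$ be the diagram with top-aligned columns $C_1,\dots,C_r$, from left to right, $C_v$ consisting of $n_v$ boxes; $R_u$ is its $u$-th row from above, $R^i=R_1\cup\dots\cup R_i$, and $\operatorname{ht}\mathscr D=\max_v n_v$. For boxes $b,b'$ write $b<b'$ (resp. $b\le b'$) if the column of $b$ is strictly to the left of (resp. to the left of or equal to) that of $b'$. Two columns $C,C'$ (with $C$ on the left) are neighbouring of height $s$ if both have height $s$ and no column strictly between them has height $s$. Two boxes of the same row are adjacent if no box of that row lies between them. All lines join two boxes, go strictly from left to right and are labelled $1$ or $0$; a line lies between two columns if both its ends lie in these columns or in columns between them. Steps 1 and 2. Join any two adjacent boxes by a (horizontal) line. For each pair of neighbouring columns $C,C'$ of height $s$, label by $0$ the rightmost line of $R_s$ between $C$ and $C'$ (the one ending in $C'$). Label all other lines by $1$. No line is gated. Step 3. For $i=1,2,\dots,\operatorname{ht}\mathscr D$ perform the following $i$-th stage, simultaneously for all pairs $C,C'$ of neighbouring columns of height $i$. Let $b''_1<\dots<b''_v$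 be the boxes of $R_i$ between $C$ and $C'$, with $b''_1\in C$ and $b''_v\in C'$. Consider the ungated lines labelled $0$ which lie between $C$ and $C'$ and have both ends in $R^{i-1}$. Gate all of them; gated lines stay in the diagram and keep the label $0$. For each $k$ such that at least one of these lines lies between the columns of $b''_k$ and $b''_{k+1}$, let $(b_1,b'_1),\dots,(b_u,b'_u)$ be those that do, numbered from left to right. Remove the line joining $b''_k$ to $b''_{k+1}$, and draw the new lines joining $b''_k$ to $b'_1$, $b_j$ to $b'_{j+1}$ for $1\le j<u$, and $b_u$ to $b''_{k+1}$. The new lines are labelled $1$, except that the line joining $b_u$ to $b''_{k+1}$ is labelled $0$ (and ungated) if $k+1=v$. A composite line is a concatenation of lines (of either label, gated or not) going strictly from left to right; a single box is also allowed. A union of composite lines is disjoint if no two of them pass through a common box. Then for every $i\le\operatorname{ht}\mathscr D$, after the $i$-th stage: $(P_1^i)$ there is a unique disjoint union of $i$ composite lines on which all the boxes of $R^i$ lie; (strict non-overlapping) the ungated lines labelled $0$ with both ends in $R^i$ can be numbered $(b_1,b'_1),(b_2,b'_2),\dots$ such that $b_1<b'_1\le b_2<b'_2\le\cdots$. Moreover,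 after all the stages, the following hold for every pair of neighbouring columns $C,C'$ of any height $s$: $(P_1)$ there is a unique disjoint union of $s$ composite lines joining the boxes $C\cap R_k$ to the boxes $C'\cap R_{\sigma(k)}$ ($1\le k\le s$) for some permutation $\sigma$ of $\{1,\dots,s\}$, and it passes through every box of $R^s$ between $C$ and $C'$; $(P_2)$ of the lines which make up these composite lines, exactly one is labelled $0$ and all others are labelled $1$. In particular $(P_1)$ and $(P_2)$ can be achieved for every parabolic in type $A$. -/

import Mathlib

namespace ParabolicTableau

/-- A diagram is given by the heights `h v` of its columns, listed from left to right.  A box is a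
column together with a position in that column (counted from the top, starting at `0`). -/
abbrev Box {r : ℕ} (h : Fin r → ℕ) : Type := (v : Fin r) × Fin (h v)

/-- The column of a box. -/
def col {r : ℕ} {h : Fin r → ℕ} (b : Box h) : Fin r := b.1

/-- The row of a box; the top row is row `1`. -/
def row {r : ℕ} {h : Fin r → ℕ} (b : Box h) : ℕ := b.2.val + 1

/-- The height of the diagram. -/
def height {r : ℕ} (h : Fin r → ℕ) : ℕ := Finset.univ.sup h

/-- `C` (left) and `C'` (right) are neighbouring columns of height `s`. -/
def Neighbouring {r : ℕ} (h : Fin r → ℕ) (s : ℕ) (C C' : Fin r) : Prop :=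
  C < C' ∧ h C = s ∧ h C' = s ∧ ∀ x, C < x → x < C' → h x ≠ s

/-- `b` (left) and `b'` (right) are adjacent boxes: they lie on the same row and there is no box
of that row between them. -/
def Adjacent {r : ℕ} {h : Fin r → ℕ} (b b' : Box h) : Prop :=
  row b = row b' ∧ col b < col b' ∧ ∀ x, col b < x → x < col b' → h x < row b

/-- The possible states of an ordered pair of boxes: not joined by a line, joined by a line
labelled `1`, by an ungated line labelled `0`, or by a gated line (still present and still
labelled `0`). -/
inductive Mark : Type
  | absent
  | one
  | zero
  | gated

/-- A labelled line diagram on the boxes; the first box of a line is its left end. -/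
abbrev Diagram {r : ℕ} (h : Fin r → ℕ) : Type := Box h → Box h → Mark

/-- The pair of boxes is joined by a line (of any label, gated or not). -/
def Line {r : ℕ} {h : Fin r → ℕ} (D : Diagram h) (b b' : Box h) : Prop :=
  D b b' ≠ Mark.absent

/-- The pair of boxes is joined by a line labelled `0` (gated or not). -/
def ZeroLine {r : ℕ} {h : Fin r → ℕ} (D : Diagram h) (b b' : Box h) : Prop :=
  D b b' = Mark.zero ∨ D b b' = Mark.gated

/-- The pair of boxes is joined by an ungated line labelled `0`, and both boxes lie in the
first `i` rows. -/
def Ungated {r : ℕ} {h : Fin r → ℕ} (D : Diagram h) (i : ℕ) (b b' : Box h) : Prop :=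
  D b b' = Mark.zero ∧ row b ≤ i ∧ row b' ≤ i

/-! ### Steps one and two -/

open Classical in
/-- Adjacent boxes are joined by a horizontal line.  For neighbouring columns `C, C'` of height `s`
the rightmost of the lines of row `s` between `C` and `C'`, that is, the one ending in `C'`, is
labelled `0`; all other lines are labelled `1`. -/
noncomputable def horizontalDiagram {r : ℕ} (h : Fin r → ℕ) : Diagram h := fun b b' =>
  if Adjacent b b' then
    if ∃ C, Neighbouring h (row b) C (col b') then Mark.zero else Mark.one
  else Mark.absent

/-! ### Step three: gating, removing and rejoining

The stage with number `i + 1` treats the neighbouring columns `C, C'` of height `i + 1`.  The boxes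
of row `i + 1` between them cut the region between `C` and `C'` into gaps, a gap being bounded by
two adjacent boxes `p, q` of that row. -/

/-- `(b, b')` is an ungated line of the first `i` rows lying in the gap from `p` to `q`. -/
def InGap {r : ℕ} {h : Fin r → ℕ} (D : Diagram h) (i : ℕ) (p q b b' : Box h) : Prop :=
  Ungated D i b b' ∧ col p ≤ col b ∧ col b' ≤ col q

/-- The lines which are gated at the stage `i + 1`: the ungated lines of the first `i` rows lying
between neighbouring columns of height `i + 1`. -/
def ToGate {r : ℕ} {h : Fin r → ℕ} (D : Diagram h) (i : ℕ) (b b' : Box h) : Prop :=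
  Ungated D i b b' ∧ ∃ C C', Neighbouring h (i + 1) C C' ∧ C ≤ col b ∧ col b' ≤ C'

/-- The lines of row `i + 1` which are removed at the stage `i + 1`: the lines joining adjacent
boxes `p, q` of row `i + 1` between neighbouring columns of height `i + 1` such that at least
one ungated line of the first `i` rows lies in the gap from `p` to `q`. -/
def ToRemove {r : ℕ} {h : Fin r → ℕ} (D : Diagram h) (i : ℕ) (p q : Box h) : Prop :=
  row p = i + 1 ∧ Adjacent p q ∧
  (∃ C C', Neighbouring h (i + 1) C C' ∧ C ≤ col p ∧ col q ≤ C') ∧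
  ∃ b b', InGap D i p q b b'

/-- Rejoining the left end of a removed line `(b, q)` to the right end `b'` of the first ungated
line in the gap from `b` to `q`. -/
def JoinFirst {r : ℕ} {h : Fin r → ℕ} (D : Diagram h) (i : ℕ) (b b' : Box h) : Prop :=
  ∃ q c, ToRemove D i b q ∧ InGap D i b q c b' ∧
    ∀ d d', InGap D i b q d d' → col b' ≤ col d'

/-- Rejoining the left end `b` of an ungated line `(b, c')` to the right end `b'` of the next
ungated line `(c, b')` in the same gap. -/
def JoinNext {r : ℕ} {h : Fin r → ℕ} (D : Diagram h) (i : ℕ) (b b' : Box h) : Prop :=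
  ∃ p q c c', ToRemove D i p q ∧ InGap D i p q b c' ∧ InGap D i p q c b' ∧ col c' ≤ col c ∧
    ∀ d d', InGap D i p q d d' → col d ≤ col b ∨ col c ≤ col d

/-- Rejoining the left end `b` of the last ungated line in the gap from `p` to `b'` to the right
end `b'` of the removed line `(p, b')`. -/
def JoinLast {r : ℕ} {h : Fin r → ℕ} (D : Diagram h) (i : ℕ) (b b' : Box h) : Prop :=
  ∃ p c', ToRemove D i p b' ∧ InGap D i p b' b c' ∧
    ∀ d d', InGap D i p b' d d' → col d ≤ col b

open Classical in
/-- The stage `i + 1`.  New lines are labelled `1`, except that the new line which ends in the right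
one of two neighbouring columns of height `i + 1` (in place of a removed line labelled `0`)
is labelled `0`. -/
noncomputable def stage {r : ℕ} {h : Fin r → ℕ} (D : Diagram h) (i : ℕ) : Diagram h := fun b b' =>
  if ToGate D i b b' then Mark.gated
  else if ToRemove D i b b' then Mark.absent
  else if JoinFirst D i b b' ∨ JoinNext D i b b' then Mark.one
  else if JoinLast D i b b' then
    if h (col b') = i + 1 then Mark.zero else Mark.one
  else D b b'

/-- The diagram after the stages `1, …, i` of step three. -/
noncomputable def diagramAfter {r : ℕ} (h : Fin r → ℕ) : ℕ → Diagram h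
  | 0 => horizontalDiagram h
  | i + 1 => stage (diagramAfter h i) i

/-- The diagram after all stages of step three. -/
noncomputable def finalDiagram {r : ℕ} (h : Fin r → ℕ) : Diagram h :=
  diagramAfter h (height h)

/-! ### Composite lines and the properties -/

/-- A composite line, as the list of the boxes it passes through: a concatenation of lines going
strictly from left to right; a single box is allowed. -/
def IsComposite {r : ℕ} {h : Fin r → ℕ} (D : Diagram h) (l : List (Box h)) : Prop :=
  l ≠ [] ∧ l.IsChain (fun b b' => col b < col b' ∧ Line D b b')

/-- `F` is a disjoint union of `i` composite lines on which all boxes of the first `i` rows lie. -/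
def CoversRows {r : ℕ} {h : Fin r → ℕ} (D : Diagram h) (i : ℕ) (F : Finset (List (Box h))) : Prop :=
  F.card = i ∧ (∀ l ∈ F, IsComposite D l) ∧
  (∀ l ∈ F, ∀ m ∈ F, l ≠ m → List.Disjoint l m) ∧
  ∀ b : Box h, row b ≤ i → ∃ l ∈ F, b ∈ l

/-- The boxes of the first `i` rows lie on a unique disjoint union of `i` composite lines. -/
def RowsProperty {r : ℕ} {h : Fin r → ℕ} (D : Diagram h) (i : ℕ) : Prop :=
  ∃! F : Finset (List (Box h)), CoversRows D i F

/-- Strict non-overlapping of the ungated lines in the first `i` rows: they all go strictly from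
left to right, and of any two different ones, one ends before or in the column in which
the other one starts. -/
def NonOverlapping {r : ℕ} {h : Fin r → ℕ} (D : Diagram h) (i : ℕ) : Prop :=
  (∀ b b' : Box h, Ungated D i b b' → col b < col b') ∧
  ∀ b b' c c' : Box h, Ungated D i b b' → Ungated D i c c' → (b, b') ≠ (c, c') →
    col b' ≤ col c ∨ col c' ≤ col b

/-- `F` is a disjoint union of composite lines joining, for some bijection `σ`, the `k`-th box of
the column `C` to the `σ k`-th box of the column `C'`. -/
def JoinsColumns {r : ℕ} {h : Fin r → ℕ} (D : Diagram h) (C C' : Fin r)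
    (F : Fin (h C) → List (Box h)) : Prop :=
  (∀ k, IsComposite D (F k)) ∧ (∀ k m, k ≠ m → List.Disjoint (F k) (F m)) ∧
  ∃ σ : Fin (h C) ≃ Fin (h C'), ∀ k,
    (F k).head? = some (⟨C, k⟩ : Box h) ∧ (F k).getLast? = some (⟨C', σ k⟩ : Box h)

/-- For any neighbouring columns `C, C'` of the same height `s` there is a unique disjoint union
of `s` composite lines joining the boxes of `C` to those of `C'` up to a permutation; and it passes
through every box of the first `s` rows between `C` and `C'`. -/
def PropertyOne {r : ℕ} {h : Fin r → ℕ} (D : Diagram h) : Prop :=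
  ∀ (s : ℕ) (C C' : Fin r), Neighbouring h s C C' →
    ∃ F : Fin (h C) → List (Box h), JoinsColumns D C C' F ∧
      (∀ G : Fin (h C) → List (Box h), JoinsColumns D C C' G → G = F) ∧
      ∀ b : Box h, row b ≤ s → C ≤ col b → col b ≤ C' → ∃ k, b ∈ F k

/-- Exactly one of the lines making up the composite lines in a disjoint union joining two
neighbouring columns is labelled `0` (and hence all others are labelled `1`). -/
def PropertyTwo {r : ℕ} {h : Fin r → ℕ} (D : Diagram h) : Prop :=
  ∀ (s : ℕ) (C C' : Fin r), Neighbouring h s C C' →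
    ∀ F : Fin (h C) → List (Box h), JoinsColumns D C C' F →
      ∃! e : Box h × Box h, (∃ k, [e.1, e.2] <:+: F k) ∧ ZeroLine D e.1 e.2

end ParabolicTableau

/-!
Call a line *active* if it is not gated.  After every stage the active lines form a partial
injection: a box has an active line to the right (left) precisely when it is not the last (first)
box of its row.  Indeed, in a gap between adjacent boxes `p, q` of the row `i + 1` a stage replaces
the active lines `(p, q), (b₁, b'₁), …, (b_u, b'_u)` by the active lines
`(p, b'₁), (b₁, b'₂), …, (b_u, q)`, which have the same left ends and the same right ends.
Following active lines thus gives the required composite lines.  Moreover no line in the first `i`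
rows jumps over a column of height at least `i`, so these composite lines meet every such column;
this also yields the strict non-overlapping.  These facts make up the invariant `Inv`, which is
preserved by `Inv.stage`.

Uniqueness rests on a potential.  When `(b_j, b'_j)` is gated, the active line into `b'_j` comes to
start at `b_{j-1}` or `p`, which is further to the left, or in the same column and lower down.
So for every line `(x, y)` the active line into `y` starts at `x` or at a box preceding `x` in the
order `pot`.  A competing family of composite lines is an injective map `g` on the boxes which have
an active successor, and `x ↦` (the active predecessor of `g x`) is a permutation which nowhere
increases the potential.  It is therefore the identity, and `g` follows the active lines
(`rel_of_potential`).

For neighbouring columns of height `s`, the stage `s` gates all ungated lines of the first `s` rows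
between them except the one into the foot of the right column (`eq_foot_of_zero`, `zero_of_foot`).
Later stages rejoin no line leaving a box of these rows within this window
(`diagramAfter_eq_or_gated`).  So the composite lines between the two columns, and the labels on
them, are already determined after the stage `s`.
-/

namespace ParabolicTableau

variable {r : ℕ} {h : Fin r → ℕ}

/-! ### Boxes and potentials -/

theorem Box.ext_col_row {b b' : Box h} (hc : col b = col b') (hr : row b = row b') : b = b' := by
  obtain ⟨v, k⟩ := b
  obtain ⟨v', k'⟩ := b'
  obtain rfl : v = v' := hc
  have : k = k' := Fin.ext (by simpa [row] using hr)
  rw [this]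

theorem row_le (b : Box h) : row b ≤ h (col b) := b.2.isLt

theorem row_pos (b : Box h) : 0 < row b := Nat.succ_pos _

theorem exists_box {v : Fin r} {k : ℕ} (hk : 0 < k) (hv : k ≤ h v) :
    ∃ b : Box h, col b = v ∧ row b = k :=
  ⟨⟨v, ⟨k - 1, by omega⟩⟩, rfl, by simp [row]; omega⟩

theorem row_le_height (b : Box h) : row b ≤ height h :=
  (row_le b).trans (Finset.le_sup (f := h) (Finset.mem_univ _))

/-- The rank of a box when columns are read from left to right and each column from bottom to
top.  It is what decreases along the alternating walks of the uniqueness argument. -/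
def pot (b : Box h) : ℤ := (col b : ℤ) * (height h + 1) - row b

theorem pot_lt_of_col_lt {b b' : Box h} (hc : col b < col b') : pot b < pot b' := by
  have h1 : ((col b : ℕ) : ℤ) + 1 ≤ (col b' : ℕ) := by exact_mod_cast hc
  have h2 : (row b' : ℤ) ≤ height h := by exact_mod_cast row_le_height b'
  have h3 : (0 : ℤ) < row b := by exact_mod_cast row_pos b
  have h4 : (0 : ℤ) ≤ height h := by positivity
  unfold pot
  nlinarith

theorem pot_lt_of_row_lt {b b' : Box h} (hc : col b ≤ col b') (hr : row b' < row b) :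
    pot b < pot b' := by
  rcases hc.lt_or_eq with hc | hc
  · exact pot_lt_of_col_lt hc
  · unfold pot
    rw [hc]
    omega

/-! ### The invariant of the stages -/

/-- The pair of boxes is joined by a line which has not been gated.  The active lines form the
disjoint union of composite lines which is to be proved unique. -/
def Active (D : Diagram h) (b b' : Box h) : Prop := D b b' = Mark.one ∨ D b b' = Mark.zero

theorem Active.line {D : Diagram h} {b b' : Box h} (hb : Active D b b') : Line D b b' := by
  rcases hb with hb | hb <;> simp [Line, hb]

theorem Line.active_or_gated {D : Diagram h} {b b' : Box h} (hb : Line D b b') :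
    Active D b b' ∨ D b b' = Mark.gated := by
  unfold Line Active at *
  cases hD : D b b' <;> simp_all

/-- The properties of the diagram after the stage `i` which are carried from stage to stage. -/
structure Inv (D : Diagram h) (i : ℕ) : Prop where
  horizontal : ∀ x y, i < row x ∨ i < row y → D x y = horizontalDiagram h x y
  col_lt : ∀ x y, Line D x y → col x < col y
  height_lt : ∀ x y, Line D x y → row x ≤ i → ∀ z, col x < z → z < col y → h z < i
  functional : ∀ x y y', Active D x y → Active D x y' → y = y'
  injective : ∀ x x' y, Active D x y → Active D x' y → x = x'
  exists_succ : ∀ x z : Box h, row z = row x → col x < col z → ∃ y, Active D x y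
  exists_pred : ∀ y z : Box h, row z = row y → col z < col y → ∃ x, Active D x y
  exists_right : ∀ x y, Line D x y → ∃ z : Box h, row z = row x ∧ col x < col z
  exists_left : ∀ x y, Line D x y → ∃ z : Box h, row z = row y ∧ col z < col y
  /-- The active line into the right end of a gated line starts at a lower potential. -/
  gated : ∀ x y, D x y = Mark.gated → ∃ x', Active D x' y ∧ pot x' < pot x
  nonOverlapping : NonOverlapping D i

theorem line_horizontal {b b' : Box h} : Line (horizontalDiagram h) b b' ↔ Adjacent b b' := by
  unfold Line horizontalDiagram
  split_ifs <;> simp_all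

theorem active_horizontal {b b' : Box h} : Active (horizontalDiagram h) b b' ↔ Adjacent b b' := by
  unfold Active horizontalDiagram
  split_ifs <;> simp_all

theorem Adjacent.eq_right {p q q' : Box h} (h1 : Adjacent p q) (h2 : Adjacent p q') : q = q' := by
  obtain ⟨hr, hc, ha⟩ := h1
  obtain ⟨hr', hc', ha'⟩ := h2
  refine Box.ext_col_row (le_antisymm ?_ ?_) (hr ▸ hr')
  · by_contra! hlt
    have := ha _ hc' hlt
    have := row_le q'
    omega
  · by_contra! hlt
    have := ha' _ hc hlt
    have := row_le q
    omega

theorem Adjacent.eq_left {p p' q : Box h} (h1 : Adjacent p q) (h2 : Adjacent p' q) : p = p' := by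
  obtain ⟨hr, hc, ha⟩ := h1
  obtain ⟨hr', hc', ha'⟩ := h2
  refine Box.ext_col_row (le_antisymm ?_ ?_) (hr.trans hr'.symm)
  · by_contra! hlt
    have := ha' _ hlt hc
    have := row_le p
    omega
  · by_contra! hlt
    have := ha _ hlt hc'
    have := row_le p'
    omega

theorem exists_adjacent_right {x z : Box h} (hr : row z = row x) (hc : col x < col z) :
    ∃ y, Adjacent x y := by
  obtain ⟨v, ⟨hv1, hv2⟩, hmin⟩ := (Set.toFinite {v : Fin r | col x < v ∧ row x ≤ h v}).exists_minimal
    ⟨col z, hc, hr ▸ row_le z⟩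
  obtain ⟨y, hy1, hy2⟩ := exists_box (row_pos x) hv2
  refine ⟨y, hy2.symm, hy1 ▸ hv1, fun w hw1 hw2 => ?_⟩
  by_contra! hw
  exact absurd (hmin ⟨hw1, hw⟩ (hy1 ▸ hw2.le)) (not_le.2 (hy1 ▸ hw2))

theorem exists_adjacent_left {y z : Box h} (hr : row z = row y) (hc : col z < col y) :
    ∃ x, Adjacent x y := by
  obtain ⟨v, ⟨hv1, hv2⟩, hmax⟩ := (Set.toFinite {v : Fin r | v < col y ∧ row y ≤ h v}).exists_maximal
    ⟨col z, hc, hr ▸ row_le z⟩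
  obtain ⟨x, hx1, hx2⟩ := exists_box (row_pos y) hv2
  refine ⟨x, hx2, hx1 ▸ hv1, fun w hw1 hw2 => ?_⟩
  by_contra! hw
  exact absurd (hmax ⟨hw2, hx2 ▸ hw⟩ (hx1 ▸ hw1.le)) (not_le.2 (hx1 ▸ hw1))

theorem inv_horizontalDiagram : Inv (horizontalDiagram h) 0 where
  horizontal _ _ _ := rfl
  col_lt _ _ hl := (line_horizontal.1 hl).2.1
  height_lt x _ _ hx := absurd hx (not_le.2 (row_pos x))
  functional _ _ _ h1 h2 := (active_horizontal.1 h1).eq_right (active_horizontal.1 h2)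
  injective _ _ _ h1 h2 := (active_horizontal.1 h1).eq_left (active_horizontal.1 h2)
  exists_succ x z hr hc := by
    obtain ⟨y, hy⟩ := exists_adjacent_right hr hc
    exact ⟨y, active_horizontal.2 hy⟩
  exists_pred y z hr hc := by
    obtain ⟨x, hx⟩ := exists_adjacent_left hr hc
    exact ⟨x, active_horizontal.2 hx⟩
  exists_right x y hl := ⟨y, (line_horizontal.1 hl).1.symm, (line_horizontal.1 hl).2.1⟩
  exists_left x y hl := ⟨x, (line_horizontal.1 hl).1, (line_horizontal.1 hl).2.1⟩
  gated x y hg := by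
    unfold horizontalDiagram at hg
    split_ifs at hg
  nonOverlapping := ⟨fun b _ hb => absurd hb.2.1 (not_le.2 (row_pos b)),
    fun b _ _ _ hb => absurd hb.2.1 (not_le.2 (row_pos b))⟩

/-! ### One stage: gaps and rejoined lines -/

variable {D : Diagram h} {i : ℕ}

theorem Ungated.active {x y : Box h} (hu : Ungated D i x y) : Active D x y := Or.inr hu.1

theorem ToRemove.row_right {p q : Box h} (hR : ToRemove D i p q) : row q = i + 1 :=
  hR.2.1.1 ▸ hR.1

theorem InGap.toGate {p q b b' : Box h} (hG : InGap D i p q b b') (hR : ToRemove D i p q) :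
    ToGate D i b b' := by
  obtain ⟨-, -, ⟨C, C', hN, h1, h2⟩, -⟩ := hR
  exact ⟨hG.1, C, C', hN, h1.trans hG.2.1, hG.2.2.trans h2⟩

/-- The lines rejoined at the stage `i + 1`. -/
def Join (D : Diagram h) (i : ℕ) (x y : Box h) : Prop :=
  JoinFirst D i x y ∨ JoinNext D i x y ∨ JoinLast D i x y

/-- A rejoined line lies in the gap of a removed line. -/
theorem Join.exists_gap {x y : Box h} (hJ : Join D i x y) :
    ∃ p q, ToRemove D i p q ∧ col p ≤ col x ∧ col y ≤ col q := by
  rcases hJ with ⟨q, c, hR, hG, -⟩ | ⟨p, q, c, c', hR, hG, hG', -⟩ | ⟨p, c', hR, hG, -⟩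
  · exact ⟨x, q, hR, le_rfl, hG.2.2⟩
  · exact ⟨p, q, hR, hG.2.1, hG'.2.2⟩
  · exact ⟨p, y, hR, hG.2.1, le_rfl⟩

namespace Inv

variable (I : Inv D i)
include I

theorem active_of_toRemove {p q : Box h} (hR : ToRemove D i p q) : Active D p q := by
  have := I.horizontal p q (Or.inl (by rw [hR.1]; omega))
  unfold Active
  rw [this]
  exact active_horizontal.2 hR.2.1

theorem col_lt_of_inGap {p q b b' : Box h} (hG : InGap D i p q b b') : col b < col b' :=
  I.col_lt _ _ hG.1.active.line

theorem gap_unique {p q p' q' b b' : Box h} (hR : ToRemove D i p q) (hR' : ToRemove D i p' q')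
    (hG : InGap D i p q b b') (hG' : InGap D i p' q' b b') : p = p' ∧ q = q' := by
  have hb := I.col_lt_of_inGap hG
  have key : ∀ {p q p' q' : Box h}, ToRemove D i p q → ToRemove D i p' q' →
      InGap D i p q b b' → InGap D i p' q' b b' → col p' ≤ col p := by
    intro p q p' q' hR hR' hG hG'
    by_contra! hlt
    have := hR.2.1.2.2 _ hlt (hG'.2.1.trans_lt (hb.trans_le hG.2.2))
    have := row_le p'
    have := hR.1
    have := hR'.1
    omega
  have hp : p = p' := Box.ext_col_row (le_antisymm (key hR' hR hG' hG) (key hR hR' hG hG'))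
    (hR.1.trans hR'.1.symm)
  subst hp
  exact ⟨rfl, hR.2.1.eq_right hR'.2.1⟩

/-- Two lines in a gap coincide or one ends before the other starts. -/
theorem inGap_trichotomy {p q b b' c c' : Box h} (hG : InGap D i p q b b')
    (hG' : InGap D i p q c c') : (b = c ∧ b' = c') ∨ col b' ≤ col c ∨ col c' ≤ col b := by
  by_cases he : (b, b') = (c, c')
  · exact Or.inl (by simpa using he)
  · exact Or.inr (I.nonOverlapping.2 _ _ _ _ hG.1 hG'.1 he)

/-- A line to be gated lies in a gap, as it does not jump over columns of height `i + 1`. -/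
theorem exists_gap {b b' : Box h} (hT : ToGate D i b b') :
    ∃ p q, ToRemove D i p q ∧ InGap D i p q b b' := by
  obtain ⟨hU, C, C', hN, h1, h2⟩ := hT
  have hlt := I.col_lt _ _ hU.active.line
  obtain ⟨v, ⟨hv1, hv2⟩, hmax⟩ :=
    (Set.toFinite {v : Fin r | v ≤ col b ∧ i + 1 ≤ h v}).exists_maximal ⟨C, h1, hN.2.1.ge⟩
  obtain ⟨w, ⟨hw1, hw2⟩, hmin⟩ :=
    (Set.toFinite {w : Fin r | col b' ≤ w ∧ i + 1 ≤ h w}).exists_minimal ⟨C', h2, hN.2.2.1.ge⟩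
  obtain ⟨p, hp, hpr⟩ := exists_box (Nat.succ_pos i) hv2
  obtain ⟨q, hq, hqr⟩ := exists_box (Nat.succ_pos i) hw2
  subst hp hq
  have hCp : C ≤ col p := by
    by_contra! hc
    exact absurd (hmax ⟨h1, hN.2.1.ge⟩ hc.le) (not_le.2 hc)
  have hqC : col q ≤ C' := by
    by_contra! hc
    exact absurd (hmin ⟨h2, hN.2.2.1.ge⟩ hc.le) (not_le.2 hc)
  have hG : InGap D i p q b b' := ⟨hU, hv1, hw1⟩
  refine ⟨p, q, ⟨hpr, ⟨hpr.trans hqr.symm, hv1.trans_lt (hlt.trans_le hw1), fun z hz1 hz2 => ?_⟩,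
    ⟨C, C', hN, hCp, hqC⟩, b, b', hG⟩, hG⟩
  rw [hpr]
  by_contra! hz
  rcases le_or_gt z (col b) with h3 | h3
  · exact absurd (hmax ⟨h3, hz⟩ hz1.le) (not_le.2 hz1)
  rcases le_or_gt (col b') z with h4 | h4
  · exact absurd (hmin ⟨h4, hz⟩ hz2.le) (not_le.2 hz2)
  have := I.height_lt _ _ hU.active.line hU.2.1 z h3 h4
  omega

theorem not_toGate_of_join {x y : Box h} (hJ : Join D i x y) : ¬ ToGate D i x y := by
  intro hT
  rcases hJ with ⟨q, c, hR, -⟩ | ⟨p, q, c, c', hR, hG, hG', hle, -⟩ | ⟨p, c', hR, hG, -⟩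
  · have := hR.1
    have := hT.1.2.1
    omega
  · obtain rfl := I.functional _ _ _ hT.1.active hG.1.active
    obtain rfl := I.injective _ _ _ hT.1.active hG'.1.active
    exact absurd (I.col_lt_of_inGap hG) (not_lt.2 hle)
  · have := hR.row_right
    have := hT.1.2.2
    omega

omit I in
theorem not_toRemove_of_join {x y : Box h} (hJ : Join D i x y) : ¬ ToRemove D i x y := by
  intro hT
  have h1 := hT.1
  have h2 := hT.row_right
  rcases hJ with ⟨q, c, hR, hG, -⟩ | ⟨p, q, c, c', hR, hG, hG', hle, -⟩ | ⟨p, c', hR, hG, -⟩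
  · have := hG.1.2.2
    omega
  · have := hG.1.2.1
    omega
  · have := hG.1.2.1
    omega

theorem active_stage_iff {x y : Box h} : Active (stage D i) x y ↔
    Join D i x y ∨ (Active D x y ∧ ¬ ToGate D i x y ∧ ¬ ToRemove D i x y) := by
  constructor
  · intro hA
    unfold Active stage at hA
    unfold Join
    split_ifs at hA <;> simp_all [Active]
    tauto
  · rintro (hJ | ⟨hA, h1, h2⟩)
    · have h1 := I.not_toGate_of_join hJ
      have h2 := not_toRemove_of_join hJ
      unfold Active stage
      unfold Join at hJ
      rw [if_neg h1, if_neg h2]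
      split_ifs <;> simp_all
    · unfold Active stage
      rw [if_neg h1, if_neg h2]
      unfold Active at hA
      split_ifs <;> simp_all

omit I in
theorem gated_stage {x y : Box h} (hg : stage D i x y = Mark.gated) :
    ToGate D i x y ∨ D x y = Mark.gated := by
  unfold stage at hg
  split_ifs at hg <;> simp_all

/-- The new line into the right end of a line of a gap starts at the preceding left end, or at the
left end `p` of the gap; `p` may lie in the same column as `b`, but then it lies below it. -/
theorem exists_join_to_inGap {p q b b' : Box h} (hR : ToRemove D i p q)
    (hG : InGap D i p q b b') : ∃ x, Join D i x b' ∧ pot x < pot b := by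
  by_cases hex : ∃ d d', InGap D i p q d d' ∧ col d < col b
  · obtain ⟨d, ⟨⟨d', hd⟩, hdb⟩, hmax⟩ := Set.exists_max_image
      {d : Box h | (∃ d', InGap D i p q d d') ∧ col d < col b} col (Set.toFinite _)
      (by obtain ⟨d, d', h1, h2⟩ := hex; exact ⟨d, ⟨d', h1⟩, h2⟩)
    refine ⟨d, Or.inr (Or.inl ⟨p, q, b, d', hR, hd, hG, ?_, fun e e' he => ?_⟩),
      pot_lt_of_col_lt hdb⟩
    · rcases I.inGap_trichotomy hd hG with h1 | h1 | h1
      · exact absurd hdb (by rw [h1.1]; exact lt_irrefl _)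
      · exact h1
      · exact absurd (h1.trans_lt hdb) (not_lt.2 (I.col_lt_of_inGap hG).le)
    · rcases lt_or_ge (col e) (col b) with h1 | h1
      · exact Or.inl (hmax e ⟨⟨e', he⟩, h1⟩)
      · exact Or.inr h1
  · push Not at hex
    refine ⟨p, Or.inl ⟨q, b, hR, hG, fun d d' hd => ?_⟩, pot_lt_of_row_lt hG.2.1 ?_⟩
    · rcases I.inGap_trichotomy hG hd with h1 | h1 | h1
      · rw [h1.2]
      · exact h1.trans (I.col_lt_of_inGap hd).le
      · exact absurd ((I.col_lt_of_inGap hd).trans_le h1) (not_lt.2 (hex d d' hd))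
    · have := hR.1
      have := hG.1.2.1
      omega

theorem exists_join_from_inGap {p q b b' : Box h} (hR : ToRemove D i p q)
    (hG : InGap D i p q b b') : ∃ y, Join D i b y := by
  by_cases hex : ∃ d d', InGap D i p q d d' ∧ col b < col d
  · obtain ⟨d, ⟨⟨d', hd⟩, hdb⟩, hmin⟩ := Set.exists_min_image
      {d : Box h | (∃ d', InGap D i p q d d') ∧ col b < col d} col (Set.toFinite _)
      (by obtain ⟨d, d', h1, h2⟩ := hex; exact ⟨d, ⟨d', h1⟩, h2⟩)
    refine ⟨d', Or.inr (Or.inl ⟨p, q, d, b', hR, hG, hd, ?_, fun e e' he => ?_⟩)⟩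
    · rcases I.inGap_trichotomy hG hd with h1 | h1 | h1
      · exact absurd hdb (by rw [h1.1]; exact lt_irrefl _)
      · exact h1
      · exact absurd (h1.trans_lt hdb) (not_lt.2 (I.col_lt_of_inGap hd).le)
    · rcases lt_or_ge (col b) (col e) with h1 | h1
      · exact Or.inr (hmin e ⟨⟨e', he⟩, h1⟩)
      · exact Or.inl h1
  · push Not at hex
    exact ⟨q, Or.inr (Or.inr ⟨p, b', hR, hG, hex⟩)⟩

omit I in
theorem exists_join_of_toRemove {p q : Box h} (hR : ToRemove D i p q) :
    (∃ y, Join D i p y) ∧ ∃ x, Join D i x q := by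
  obtain ⟨b, b', hG⟩ := hR.2.2.2
  obtain ⟨c, ⟨d, hcd⟩, hmin⟩ := Set.exists_min_image
    {c : Box h | ∃ d, InGap D i p q d c} col (Set.toFinite _) ⟨b', b, hG⟩
  obtain ⟨e, ⟨f, hef⟩, hmax⟩ := Set.exists_max_image
    {c : Box h | ∃ d, InGap D i p q c d} col (Set.toFinite _) ⟨b, b', hG⟩
  exact ⟨⟨c, Or.inl ⟨q, d, hR, hcd, fun x x' hx => hmin x' ⟨x, hx⟩⟩⟩,
    e, Or.inr (Or.inr ⟨p, f, hR, hef, fun x x' hx => hmax x ⟨x', hx⟩⟩)⟩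

/-- The active line out of the box `x` is either kept or replaced. -/
theorem exists_active_stage_right {x y : Box h} (hA : Active D x y) :
    ∃ y', Active (stage D i) x y' := by
  by_cases h1 : ToGate D i x y
  · obtain ⟨p, q, hR, hG⟩ := I.exists_gap h1
    obtain ⟨z, hz⟩ := I.exists_join_from_inGap hR hG
    exact ⟨z, I.active_stage_iff.2 (Or.inl hz)⟩
  by_cases h2 : ToRemove D i x y
  · obtain ⟨z, hz⟩ := (exists_join_of_toRemove h2).1
    exact ⟨z, I.active_stage_iff.2 (Or.inl hz)⟩
  exact ⟨y, I.active_stage_iff.2 (Or.inr ⟨hA, h1, h2⟩)⟩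

theorem exists_active_stage_left {x y : Box h} (hA : Active D x y) :
    ∃ x', Active (stage D i) x' y := by
  by_cases h1 : ToGate D i x y
  · obtain ⟨p, q, hR, hG⟩ := I.exists_gap h1
    obtain ⟨z, hz, -⟩ := I.exists_join_to_inGap hR hG
    exact ⟨z, I.active_stage_iff.2 (Or.inl hz)⟩
  by_cases h2 : ToRemove D i x y
  · obtain ⟨z, hz⟩ := (exists_join_of_toRemove h2).2
    exact ⟨z, I.active_stage_iff.2 (Or.inl hz)⟩
  exact ⟨x, I.active_stage_iff.2 (Or.inr ⟨hA, h1, h2⟩)⟩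

theorem functional_stage {x y y' : Box h} (h1 : Active (stage D i) x y)
    (h2 : Active (stage D i) x y') : y = y' := by
  -- a rejoined line and a kept line never leave the same box
  have old : ∀ {y y'}, Join D i x y → Active D x y' → ToGate D i x y' ∨ ToRemove D i x y' := by
    intro y y' hJ hA
    rcases hJ with ⟨q, c, hR, -⟩ | ⟨p, q, c, c', hR, hG, -⟩ | ⟨p, c', hR, hG, -⟩
    · rw [I.functional _ _ _ hA (I.active_of_toRemove hR)]
      exact Or.inr hR
    · rw [I.functional _ _ _ hA hG.1.active]
      exact Or.inl (hG.toGate hR)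
    · rw [I.functional _ _ _ hA hG.1.active]
      exact Or.inl (hG.toGate hR)
  rcases I.active_stage_iff.1 h1 with h1 | ⟨h1, h1g, h1r⟩ <;>
    rcases I.active_stage_iff.1 h2 with h2 | ⟨h2, h2g, h2r⟩
  · rcases h1 with ⟨q, c, hR, hG, hm⟩ | ⟨p, q, c, c', hR, hG, hG2, hle, hm⟩ | ⟨p, c', hR, hG, hm⟩ <;>
      rcases h2 with ⟨q', d, hR', hG', hm'⟩ | ⟨p', q', d, d', hR', hG', hG2', hle', hm'⟩ |
        ⟨p', d', hR', hG', hm'⟩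
    · obtain rfl := hR.2.1.eq_right hR'.2.1
      rcases I.inGap_trichotomy hG hG' with h3 | h3 | h3
      · exact h3.2
      · exact absurd (h3.trans_lt (I.col_lt_of_inGap hG')) (not_lt.2 (hm' _ _ hG))
      · exact absurd (h3.trans_lt (I.col_lt_of_inGap hG)) (not_lt.2 (hm _ _ hG'))
    · have := hR.1; have := hG'.1.2.1; omega
    · have := hR.1; have := hG'.1.2.1; omega
    · have := hR'.1; have := hG.1.2.1; omega
    · obtain rfl := I.functional _ _ _ hG.1.active hG'.1.active
      obtain ⟨rfl, rfl⟩ := I.gap_unique hR hR' hG hG'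
      have hlt := I.col_lt_of_inGap hG
      rcases I.inGap_trichotomy hG2 hG2' with h3 | h3 | h3
      · exact h3.2
      · have h4 := (hm' _ _ hG2).resolve_left (not_le.2 (hlt.trans_le hle))
        exact absurd ((I.col_lt_of_inGap hG2).trans_le h3) (not_lt.2 h4)
      · have h4 := (hm _ _ hG2').resolve_left (not_le.2 (hlt.trans_le hle'))
        exact absurd ((I.col_lt_of_inGap hG2').trans_le h3) (not_lt.2 h4)
    · obtain rfl := I.functional _ _ _ hG.1.active hG'.1.active
      obtain ⟨rfl, rfl⟩ := I.gap_unique hR hR' hG hG'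
      exact absurd ((I.col_lt_of_inGap hG).trans_le hle) (not_lt.2 (hm' _ _ hG2))
    · have := hR'.1; have := hG.1.2.1; omega
    · obtain rfl := I.functional _ _ _ hG.1.active hG'.1.active
      obtain ⟨rfl, rfl⟩ := I.gap_unique hR hR' hG hG'
      exact absurd ((I.col_lt_of_inGap hG).trans_le hle') (not_lt.2 (hm _ _ hG2'))
    · obtain rfl := I.functional _ _ _ hG.1.active hG'.1.active
      exact (I.gap_unique hR hR' hG hG').2
  · exact ((old h1 h2).elim h2g h2r).elim
  · exact ((old h2 h1).elim h1g h1r).elim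
  · exact I.functional _ _ _ h1 h2

theorem injective_stage {x x' y : Box h} (h1 : Active (stage D i) x y)
    (h2 : Active (stage D i) x' y) : x = x' := by
  -- a rejoined line and a kept line never enter the same box
  have old : ∀ {x x'}, Join D i x y → Active D x' y → ToGate D i x' y ∨ ToRemove D i x' y := by
    intro x x' hJ hA
    rcases hJ with ⟨q, c, hR, hG, -⟩ | ⟨p, q, c, c', hR, -, hG, -⟩ | ⟨p, c', hR, -⟩
    · rw [I.injective _ _ _ hA hG.1.active]
      exact Or.inl (hG.toGate hR)
    · rw [I.injective _ _ _ hA hG.1.active]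
      exact Or.inl (hG.toGate hR)
    · rw [I.injective _ _ _ hA (I.active_of_toRemove hR)]
      exact Or.inr hR
  rcases I.active_stage_iff.1 h1 with h1 | ⟨h1, h1g, h1r⟩ <;>
    rcases I.active_stage_iff.1 h2 with h2 | ⟨h2, h2g, h2r⟩
  · rcases h1 with ⟨q, c, hR, hG, hm⟩ | ⟨p, q, c, c', hR, hG, hG2, hle, hm⟩ | ⟨p, c', hR, hG, hm⟩ <;>
      rcases h2 with ⟨q', d, hR', hG', hm'⟩ | ⟨p', q', d, d', hR', hG', hG2', hle', hm'⟩ |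
        ⟨p', d', hR', hG', hm'⟩
    · obtain rfl := I.injective _ _ _ hG.1.active hG'.1.active
      exact (I.gap_unique hR hR' hG hG').1
    · obtain rfl := I.injective _ _ _ hG.1.active hG2'.1.active
      obtain ⟨rfl, rfl⟩ := I.gap_unique hR hR' hG hG2'
      exact absurd (hle'.trans_lt (I.col_lt_of_inGap hG)) (not_lt.2 (hm _ _ hG'))
    · have := hR'.row_right; have := hG.1.2.2; omega
    · obtain rfl := I.injective _ _ _ hG2.1.active hG'.1.active
      obtain ⟨rfl, rfl⟩ := I.gap_unique hR hR' hG2 hG'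
      exact absurd (hle.trans_lt (I.col_lt_of_inGap hG')) (not_lt.2 (hm' _ _ hG))
    · obtain rfl := I.injective _ _ _ hG2.1.active hG2'.1.active
      obtain ⟨rfl, rfl⟩ := I.gap_unique hR hR' hG2 hG2'
      have h3 := (hm _ _ hG').resolve_right (not_le.2 ((I.col_lt_of_inGap hG').trans_le hle'))
      have h4 := (hm' _ _ hG).resolve_right (not_le.2 ((I.col_lt_of_inGap hG).trans_le hle))
      rcases I.inGap_trichotomy hG hG' with h5 | h5 | h5
      · exact h5.1
      · exact absurd ((I.col_lt_of_inGap hG).trans_le h5) (not_lt.2 h3)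
      · exact absurd ((I.col_lt_of_inGap hG').trans_le h5) (not_lt.2 h4)
    · have := hR'.row_right; have := hG2.1.2.2; omega
    · have := hR.row_right; have := hG'.1.2.2; omega
    · have := hR.row_right; have := hG2'.1.2.2; omega
    · obtain rfl := hR.2.1.eq_left hR'.2.1
      rcases I.inGap_trichotomy hG hG' with h5 | h5 | h5
      · exact h5.1
      · exact absurd ((I.col_lt_of_inGap hG).trans_le h5) (not_lt.2 (hm _ _ hG'))
      · exact absurd ((I.col_lt_of_inGap hG').trans_le h5) (not_lt.2 (hm' _ _ hG))
  · exact ((old h1 h2).elim h2g h2r).elim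
  · exact ((old h2 h1).elim h1g h1r).elim
  · exact I.injective _ _ _ h1 h2

theorem join_endpoints {x y : Box h} (hJ : Join D i x y) :
    (∃ z, Line D x z) ∧ (∃ z, Line D z y) ∧ row x ≤ i + 1 ∧ row y ≤ i + 1 ∧ col x < col y := by
  rcases hJ with ⟨q, c, hR, hG, hm⟩ | ⟨p, q, c, c', hR, hG, hG2, hle, hm⟩ | ⟨p, c', hR, hG, hm⟩
  · have := hG.1.2.2
    exact ⟨⟨q, (I.active_of_toRemove hR).line⟩, ⟨c, hG.1.active.line⟩, hR.1.le, by omega,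
      hG.2.1.trans_lt (I.col_lt_of_inGap hG)⟩
  · have := hG.1.2.1
    have := hG2.1.2.2
    exact ⟨⟨c', hG.1.active.line⟩, ⟨c, hG2.1.active.line⟩, by omega, by omega,
      ((I.col_lt_of_inGap hG).trans_le hle).trans (I.col_lt_of_inGap hG2)⟩
  · have := hG.1.2.1
    exact ⟨⟨c', hG.1.active.line⟩, ⟨p, (I.active_of_toRemove hR).line⟩, by omega, hR.row_right.le,
      (I.col_lt_of_inGap hG).trans_le hG.2.2⟩

theorem join_or_line_of_stage {x y : Box h} (hl : Line (stage D i) x y) :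
    Join D i x y ∨ Line D x y := by
  rcases hl.active_or_gated with hA | hg
  · exact (I.active_stage_iff.1 hA).imp_right fun hA => hA.1.line
  · rcases gated_stage hg with hT | hg
    · exact Or.inr hT.1.active.line
    · exact Or.inr (by simp [Line, hg])

theorem not_gated_of_lt_row {x y : Box h} (hr : i < row x ∨ i < row y) : D x y ≠ Mark.gated := by
  rw [I.horizontal x y hr]
  unfold horizontalDiagram
  split_ifs <;> simp

/-- An ungated line after the stage `i + 1` is either old, and then not gated, or it ends at
the foot of a column of height `i + 1` and starts to the right of all lines of the gap. -/
theorem ungated_stage {x y : Box h} (hu : Ungated (stage D i) (i + 1) x y) :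
    (Ungated D i x y ∧ ¬ ToGate D i x y) ∨
    (h (col y) = i + 1 ∧ row y = i + 1 ∧ ∃ p C, Adjacent p y ∧ Neighbouring h (i + 1) C (col y) ∧
      col p ≤ col x ∧ C ≤ col p) := by
  have hA := I.active_stage_iff.1 hu.active
  have left_le : ∀ {p C C'}, row p = i + 1 → Adjacent p y → Neighbouring h (i + 1) C C' →
      col y ≤ C' → h (col y) = i + 1 → C ≤ col p → C' = col y := by
    intro p C C' hp ha hN hC' hy hC
    rcases hC'.lt_or_eq with hlt | heq
    · exact absurd hy (hN.2.2.2 _ (hC.trans_lt ha.2.1) hlt)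
    · exact heq.symm
  rcases hA with hJ | ⟨hA, hg, hr⟩
  · have hz := hu.1
    have h1 := I.not_toGate_of_join hJ
    have h2 := not_toRemove_of_join hJ
    unfold stage at hz
    rw [if_neg h1, if_neg h2] at hz
    split_ifs at hz with h3 h4 h5
    · obtain ⟨p, c', hR, hG, -⟩ := h4
      obtain ⟨C, C', hN, hC, hC'⟩ := hR.2.2.1
      refine Or.inr ⟨h5, hR.row_right, p, C, hR.2.1, ?_, hG.2.1, hC⟩
      rw [← left_le hR.1 hR.2.1 hN hC' h5 hC]
      exact hN
    · unfold Join at hJ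
      tauto
  · by_cases hrow : row x ≤ i ∧ row y ≤ i
    · refine Or.inl ⟨⟨?_, hrow⟩, hg⟩
      have hz := hu.1
      unfold stage at hz
      rw [if_neg hg, if_neg hr] at hz
      split_ifs at hz with h3 h4 h5
      · obtain ⟨p, c', hR, -⟩ := h4
        have := hR.row_right
        omega
      · exact hz
    · have hrow' : i < row x ∨ i < row y := by omega
      have hnj : ¬ Join D i x y := by
        intro hJ
        rcases hJ with ⟨q, c, hR, hG, -⟩ | ⟨p, q, c, c', hR, hG, hG2, -⟩ | ⟨p, c', hR, hG, -⟩
        · rw [I.functional _ _ _ hA (I.active_of_toRemove hR)] at hr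
          exact hr hR
        · have := hG.1.2.1; have := hG2.1.2.2; omega
        · rw [I.functional _ _ _ hA hG.1.active] at hg
          exact hg (hG.toGate hR)
      have hz := hu.1
      unfold stage at hz
      unfold Join at hnj
      rw [if_neg hg, if_neg hr, if_neg (by tauto), if_neg (by tauto),
        I.horizontal x y hrow'] at hz
      unfold horizontalDiagram at hz
      split_ifs at hz with h3 h4
      obtain ⟨C, hC⟩ := h4
      have hx : row x = i + 1 := by
        have := h3.1; have := hu.2.1; omega
      rw [hx] at hC
      refine Or.inr ⟨hC.2.2.1, h3.1 ▸ hx, x, C, h3, hC, le_rfl, ?_⟩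
      by_contra! hlt
      have := h3.2.2 C hlt hC.1
      have := hC.2.1
      omega

theorem nonOverlapping_stage : NonOverlapping (stage D i) (i + 1) := by
  have hfwd : ∀ b b' : Box h, Ungated (stage D i) (i + 1) b b' → col b < col b' := by
    intro b b' hb
    rcases I.join_or_line_of_stage hb.active.line with hJ | hl
    · exact (I.join_endpoints hJ).2.2.2.2
    · exact I.col_lt _ _ hl
  -- an old ungated line cannot jump over a column of the gap of a new one
  have mixed : ∀ b b' c c' : Box h, Ungated D i b b' → ¬ ToGate D i b b' →
      (h (col c') = i + 1 ∧ row c' = i + 1 ∧ ∃ p C, Adjacent p c' ∧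
        Neighbouring h (i + 1) C (col c') ∧ col p ≤ col c ∧ C ≤ col p) →
      col b' ≤ col c ∨ col c' ≤ col b := by
    rintro b b' c c' hU hT ⟨h1, h2, p, C, hp, hN, hpc, hCp⟩
    by_contra! hc
    refine hT ⟨hU, C, col c', hN, ?_, ?_⟩
    · by_contra! hlt
      have := I.height_lt _ _ hU.active.line hU.2.1 (col p) (hlt.trans_le hCp)
        (hpc.trans_lt hc.1)
      have := row_le p
      have := hp.1
      omega
    · by_contra! hlt
      have := I.height_lt _ _ hU.active.line hU.2.1 (col c') hc.2 hlt
      omega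
  refine ⟨hfwd, fun b b' c c' hb hc hne => ?_⟩
  rcases I.ungated_stage hb with ⟨hb1, hb2⟩ | hb1 <;> rcases I.ungated_stage hc with ⟨hc1, hc2⟩ | hc1
  · exact I.nonOverlapping.2 _ _ _ _ hb1 hc1 hne
  · exact mixed _ _ _ _ hb1 hb2 hc1
  · exact (mixed _ _ _ _ hc1 hc2 hb1).symm
  · obtain ⟨hb1, hb2, p, -, hp, -, hpb, -⟩ := hb1
    obtain ⟨hc1, hc2, q, -, hq, -, hqc, -⟩ := hc1
    rcases lt_trichotomy (col b') (col c') with h3 | h3 | h3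
    · refine Or.inl (le_trans ?_ hqc)
      by_contra! h4
      have := hq.2.2 _ h4 h3
      have := hq.1
      omega
    · obtain rfl : b' = c' := Box.ext_col_row h3 (hb2.trans hc2.symm)
      exact absurd (by rw [I.injective_stage hb.active hc.active]) hne
    · refine Or.inr (le_trans ?_ hpb)
      by_contra! h4
      have := hp.2.2 _ h4 h3
      have := hp.1
      omega

theorem stage : Inv (stage D i) (i + 1) where
  horizontal x y hr := by
    have hJ : ¬ Join D i x y := fun hJ => by
      have := I.join_endpoints hJ
      omega
    have hT : ¬ ToGate D i x y := fun hT => by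
      have := hT.1.2
      omega
    have hR : ¬ ToRemove D i x y := fun hR => by
      have := hR.1
      have := hR.row_right
      omega
    unfold Join at hJ
    unfold ParabolicTableau.stage
    rw [if_neg hT, if_neg hR, if_neg (by tauto), if_neg (by tauto)]
    exact I.horizontal x y (by omega)
  col_lt x y hl := by
    rcases I.join_or_line_of_stage hl with hJ | hl
    · exact (I.join_endpoints hJ).2.2.2.2
    · exact I.col_lt _ _ hl
  height_lt x y hl hx z hxz hzy := by
    rcases I.join_or_line_of_stage hl with hJ | hl
    · obtain ⟨p, q, hR, hp, hq⟩ := hJ.exists_gap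
      have := hR.2.1.2.2 z (hp.trans_lt hxz) (hzy.trans_le hq)
      have := hR.1
      omega
    · rcases hx.lt_or_eq with hx | hx
      · have := I.height_lt _ _ hl (by omega) z hxz hzy
        omega
      · have h1 : Line (horizontalDiagram h) x y := by
          unfold Line
          rw [← I.horizontal x y (by omega)]
          exact hl
        have := (line_horizontal.1 h1).2.2 z hxz hzy
        omega
  functional x y y' := I.functional_stage
  injective x x' y := I.injective_stage
  exists_succ x z hr hc := by
    obtain ⟨y, hy⟩ := I.exists_succ x z hr hc
    exact I.exists_active_stage_right hy
  exists_pred y z hr hc := by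
    obtain ⟨x, hx⟩ := I.exists_pred y z hr hc
    exact I.exists_active_stage_left hx
  exists_right x y hl := by
    rcases I.join_or_line_of_stage hl with hJ | hl
    · obtain ⟨z, hz⟩ := (I.join_endpoints hJ).1
      exact I.exists_right x z hz
    · exact I.exists_right x y hl
  exists_left x y hl := by
    rcases I.join_or_line_of_stage hl with hJ | hl
    · obtain ⟨z, hz⟩ := (I.join_endpoints hJ).2.1
      exact I.exists_left z y hz
    · exact I.exists_left x y hl
  gated x y hg := by
    have new : ∀ x', ToGate D i x' y → ∃ x'', Active (ParabolicTableau.stage D i) x'' y ∧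
        pot x'' < pot x' := by
      intro x' hT
      obtain ⟨p, q, hR, hG⟩ := I.exists_gap hT
      obtain ⟨z, hz, hlt⟩ := I.exists_join_to_inGap hR hG
      exact ⟨z, I.active_stage_iff.2 (Or.inl hz), hlt⟩
    rcases gated_stage hg with hT | hg
    · exact new x hT
    · obtain ⟨x', hA, hlt⟩ := I.gated x y hg
      by_cases hT : ToGate D i x' y
      · obtain ⟨x'', h1, h2⟩ := new x' hT
        exact ⟨x'', h1, h2.trans hlt⟩
      · refine ⟨x', I.active_stage_iff.2 (Or.inr ⟨hA, hT, fun hR => ?_⟩), hlt⟩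
        have := hR.row_right
        exact I.not_gated_of_lt_row (Or.inr (by omega)) hg
  nonOverlapping := I.nonOverlapping_stage

end Inv

theorem inv_diagramAfter (h : Fin r → ℕ) (i : ℕ) : Inv (diagramAfter h i) i := by
  induction i with
  | zero => exact inv_horizontalDiagram
  | succ i ih => exact ih.stage

/-! ### Consecutive elements of lists -/

section Lists

variable {α : Type*}

theorem pair_infix_cons {a x y : α} {l : List α} :
    [x, y] <:+: a :: l ↔ (x = a ∧ l.head? = some y) ∨ [x, y] <:+: l := by
  rw [List.infix_cons_iff, List.cons_prefix_cons]
  cases l with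
  | nil => simp
  | cons b l => simp [eq_comm]

theorem isChain_iff_pair_infix {R : α → α → Prop} {l : List α} :
    l.IsChain R ↔ ∀ x y, [x, y] <:+: l → R x y := by
  induction l with
  | nil => simp
  | cons a l ih =>
    cases l with
    | nil =>
      simp only [List.IsChain.singleton, true_iff]
      intro x y hxy
      have := hxy.length_le
      simp at this
    | cons b l =>
      rw [List.isChain_cons_cons, ih]
      constructor
      · rintro ⟨h1, h2⟩ x y hxy
        rcases pair_infix_cons.1 hxy with ⟨rfl, h3⟩ | h3
        · simp only [List.head?_cons, Option.some.injEq] at h3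
          exact h3 ▸ h1
        · exact h2 x y h3
      · exact fun h1 => ⟨h1 a b (pair_infix_cons.2 (Or.inl ⟨rfl, rfl⟩)),
          fun x y hxy => h1 x y (pair_infix_cons.2 (Or.inr hxy))⟩

theorem exists_pair_infix_right {x : α} {l : List α} (hx : x ∈ l) (hne : l.getLast? ≠ some x) :
    ∃ y, [x, y] <:+: l := by
  obtain ⟨s, t, rfl⟩ := List.append_of_mem hx
  cases t with
  | nil => simp at hne
  | cons y t => exact ⟨y, s, t, by simp⟩

theorem exists_pair_infix_left {x : α} {l : List α} (hx : x ∈ l) (hne : l.head? ≠ some x) :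
    ∃ y, [y, x] <:+: l := by
  obtain ⟨s, t, rfl⟩ := List.append_of_mem hx
  rcases s.eq_nil_or_concat with rfl | ⟨s, y, rfl⟩
  · simp at hne
  · exact ⟨y, s, t, by simp⟩

theorem left_mem_of_pair_infix {x y : α} {l : List α} (hl : [x, y] <:+: l) : x ∈ l :=
  hl.subset (by simp)

theorem right_mem_of_pair_infix {x y : α} {l : List α} (hl : [x, y] <:+: l) : y ∈ l :=
  hl.subset (by simp)

theorem pair_infix_right_unique {x y z : α} {l : List α} (hn : l.Nodup) (hy : [x, y] <:+: l)
    (hz : [x, z] <:+: l) : y = z := by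
  induction l with
  | nil => simp at hy
  | cons a l ih =>
    rw [List.nodup_cons] at hn
    rcases pair_infix_cons.1 hy with ⟨rfl, h1⟩ | h1 <;>
      rcases pair_infix_cons.1 hz with ⟨h3, h2⟩ | h2
    · exact Option.some.inj (h1.symm.trans h2)
    · exact absurd (left_mem_of_pair_infix h2) hn.1
    · exact absurd (left_mem_of_pair_infix h1) (h3 ▸ hn.1)
    · exact ih hn.2 h1 h2

theorem pair_infix_left_unique {x y z : α} {l : List α} (hn : l.Nodup) (hx : [x, z] <:+: l)
    (hy : [y, z] <:+: l) : x = y := by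
  refine pair_infix_right_unique (x := z) (List.nodup_reverse.2 hn) ?_ ?_
  · simpa using List.reverse_infix.2 hx
  · simpa using List.reverse_infix.2 hy

theorem head?_ne_of_pair_infix {x y : α} {l : List α} (hn : l.Nodup) (hl : [x, y] <:+: l) :
    l.head? ≠ some y := by
  cases l with
  | nil => simp
  | cons a l =>
    rw [List.nodup_cons] at hn
    intro hy
    obtain rfl : a = y := by simpa using hy
    rcases pair_infix_cons.1 hl with ⟨-, h1⟩ | h1
    · exact hn.1 (List.mem_of_mem_head? h1)
    · exact hn.1 (right_mem_of_pair_infix h1)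

theorem forall_mem_of_head {P : α → Prop} {l : List α} {a : α} (ha : l.head? = some a) (hP : P a)
    (hs : ∀ x y, [x, y] <:+: l → P x → P y) : ∀ x ∈ l, P x := by
  induction l generalizing a with
  | nil => simp
  | cons b l ih =>
    obtain rfl : b = a := by simpa using ha
    intro x hx
    rcases List.mem_cons.1 hx with rfl | hx
    · exact hP
    cases l with
    | nil => simp at hx
    | cons c l =>
      refine ih (a := c) rfl (hs _ _ (pair_infix_cons.2 (Or.inl ⟨rfl, rfl⟩)) hP) ?_ x hx
      exact fun x y hxy => hs x y (pair_infix_cons.2 (Or.inr hxy))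

theorem forall_mem_of_getLast {P : α → Prop} {l : List α} {a : α} (ha : l.getLast? = some a)
    (hP : P a) (hs : ∀ x y, [x, y] <:+: l → P y → P x) : ∀ x ∈ l, P x := by
  intro x hx
  refine forall_mem_of_head (l := l.reverse) (a := a) (by simpa using ha) hP ?_ x (by simpa using hx)
  intro y z hyz
  exact hs z y (by simpa using List.reverse_infix.2 hyz)

/-! ### Paths of a partial injection -/

variable {T : α → α → Prop}

/-- A list which follows `T` until no continuation is possible. -/
def IsPath (T : α → α → Prop) (l : List α) : Prop :=
  l.IsChain T ∧ ∀ x, l.getLast? = some x → ∀ y, ¬ T x y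

theorem exists_isPath (hwf : WellFounded fun y x => T x y) (x : α) :
    ∃ l : List α, l.head? = some x ∧ IsPath T l := by
  induction x using hwf.induction with
  | _ x ih =>
    by_cases hx : ∃ y, T x y
    · obtain ⟨y, hy⟩ := hx
      obtain ⟨l, hl, hc, hlast⟩ := ih y hy
      cases l with
      | nil => simp at hl
      | cons b l =>
        obtain rfl : b = y := by simpa using hl
        exact ⟨x :: b :: l, rfl, List.isChain_cons_cons.2 ⟨hy, hc⟩, by simpa using hlast⟩
    · push Not at hx
      exact ⟨[x], rfl, by simp, by simpa using hx⟩

theorem IsPath.eq (hfun : ∀ x y z, T x y → T x z → y = z) {l m : List α} (hl : IsPath T l)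
    (hm : IsPath T m) (hlm : l.head? = m.head?) : l = m := by
  induction l generalizing m with
  | nil => simpa [eq_comm] using hlm
  | cons a l ih =>
    cases m with
    | nil => simp at hlm
    | cons b m =>
      obtain rfl : a = b := by simpa using hlm
      congr 1
      cases l with
      | nil =>
        cases m with
        | nil => rfl
        | cons c m => exact absurd (List.isChain_cons_cons.1 hm.1).1 (hl.2 a (by simp) c)
      | cons d l =>
        have hd := List.isChain_cons_cons.1 hl.1
        cases m with
        | nil => exact absurd hd.1 (hm.2 a (by simp) d)
        | cons c m =>
          have hc := List.isChain_cons_cons.1 hm.1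
          obtain rfl := hfun _ _ _ hd.1 hc.1
          exact ih ⟨hd.2, by simpa using hl.2⟩ ⟨hc.2, by simpa using hm.2⟩ rfl

theorem IsPath.mem_of_rel (hfun : ∀ x y z, T x y → T x z → y = z) {l : List α} (hl : IsPath T l)
    {x y : α} (hx : x ∈ l) (hxy : T x y) : y ∈ l := by
  obtain ⟨z, hz⟩ := exists_pair_infix_right hx fun hlast => hl.2 x hlast y hxy
  rw [hfun _ _ _ hxy (isChain_iff_pair_infix.1 hl.1 _ _ hz)]
  exact right_mem_of_pair_infix hz

/-- Chains of a co-functional relation which meet have the same head, if nothing precedes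
their heads. -/
theorem head?_eq_of_mem_of_mem (hinj : ∀ x y z, T x z → T y z → x = y) {l m : List α}
    (hl : l.IsChain T) (hm : m.IsChain T) (hl0 : ∀ x, l.head? = some x → ∀ y, ¬ T y x)
    (hm0 : ∀ x, m.head? = some x → ∀ y, ¬ T y x) {x : α} (hxl : x ∈ l) (hxm : x ∈ m) :
    l.head? = m.head? := by
  obtain ⟨a, ha⟩ : ∃ a, l.head? = some a := by
    cases l with
    | nil => simp at hxl
    | cons a l => exact ⟨a, rfl⟩
  refine forall_mem_of_head (P := fun x => x ∈ m → l.head? = m.head?) ha ?_ ?_ x hxl hxm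
  · intro ham
    by_contra hne
    obtain ⟨y, hy⟩ := exists_pair_infix_left ham (fun hc => hne (ha.trans hc.symm))
    exact hl0 a ha y (isChain_iff_pair_infix.1 hm _ _ hy)
  · intro x y hxy ih hym
    have h1 := isChain_iff_pair_infix.1 hl _ _ hxy
    obtain ⟨z, hz⟩ := exists_pair_infix_left hym (fun hc => hm0 y hc x h1)
    rw [hinj _ _ _ h1 (isChain_iff_pair_infix.1 hm _ _ hz)] at ih
    exact ih (left_mem_of_pair_infix hz)

/-- If `T` is a partial injection and an injective map `g` never runs ahead of `T` in the sense
that the `T`-predecessor of `g x` is `x` or of lower potential, then `g` follows `T`: the map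
sending `x` to the `T`-predecessor of `g x` is a permutation of `L` which nowhere raises the
potential, so it preserves the potential and is the identity. -/
theorem rel_of_potential {L : Finset α} {g : α → α} {pot : α → ℤ}
    (hfun : ∀ x y z, T x y → T x z → y = z) (hT : ∀ x ∈ L, ∃ x' ∈ L, T x' (g x))
    (hg : ∀ x ∈ L, ∀ x' ∈ L, g x = g x' → x = x')
    (hpot : ∀ x ∈ L, ∀ x', T x' (g x) → x' = x ∨ pot x' < pot x) : ∀ x ∈ L, T x (g x) := by
  classical
  choose! π hπL hπ using hT
  have hinj : Set.InjOn π L := fun x hx y hy hxy =>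
    hg x hx y hy (hfun _ _ _ (hπ x hx) (hxy ▸ hπ y hy))
  have himg : L.image π = L := Finset.eq_of_subset_of_card_le
    (Finset.image_subset_iff.2 hπL) (Finset.card_image_of_injOn hinj).ge
  have hsum : ∑ x ∈ L, pot (π x) = ∑ x ∈ L, pot x := by
    rw [← Finset.sum_image (g := π) hinj, himg]
  have hle : ∀ x ∈ L, pot (π x) ≤ pot x := fun x hx => by
    rcases hpot x hx _ (hπ x hx) with h1 | h1
    · rw [h1]
    · exact h1.le
  intro x hx
  have h1 := (Finset.sum_eq_sum_iff_of_le hle).1 hsum x hx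
  have h2 := hπ x hx
  rwa [(hpot x hx _ h2).resolve_right h1.not_lt] at h2

end Lists

/-- Two elements consecutive in some list of the family `S`. -/
def Consecutive {α : Type*} (S : Set (List α)) (x y : α) : Prop := ∃ l ∈ S, [x, y] <:+: l

section Family

variable {α : Type*} {S : Set (List α)} (hn : ∀ l ∈ S, l.Nodup)
  (hd : ∀ l ∈ S, ∀ m ∈ S, l ≠ m → l.Disjoint m)
include hn hd

theorem Consecutive.right_unique {x y z : α} (hy : Consecutive S x y) (hz : Consecutive S x z) :
    y = z := by
  obtain ⟨l, hl, hxy⟩ := hy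
  obtain ⟨m, hm, hxz⟩ := hz
  obtain rfl : l = m := by
    by_contra hne
    exact hd l hl m hm hne (left_mem_of_pair_infix hxy) (left_mem_of_pair_infix hxz)
  exact pair_infix_right_unique (hn l hl) hxy hxz

theorem Consecutive.left_unique {x y z : α} (hx : Consecutive S x z) (hy : Consecutive S y z) :
    x = y := by
  obtain ⟨l, hl, hxz⟩ := hx
  obtain ⟨m, hm, hyz⟩ := hy
  obtain rfl : l = m := by
    by_contra hne
    exact hd l hl m hm hne (right_mem_of_pair_infix hxz) (right_mem_of_pair_infix hyz)
  exact pair_infix_left_unique (hn l hl) hxz hyz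

end Family

theorem IsComposite.nodup {D : Diagram h} {l : List (Box h)} (hl : IsComposite D l) : l.Nodup := by
  have h1 : l.IsChain (fun b b' => col b < col b') := hl.2.imp fun _ _ hb => hb.1
  have : Trans (fun b b' : Box h => col b < col b') (fun b b' : Box h => col b < col b')
    (fun b b' : Box h => col b < col b') := ⟨fun h1 h2 => lt_trans h1 h2⟩
  exact h1.pairwise.imp fun hlt => by
    rintro rfl
    exact lt_irrefl _ hlt

theorem IsComposite.line {D : Diagram h} {l : List (Box h)} (hl : IsComposite D l) {x y : Box h}
    (hxy : [x, y] <:+: l) : Line D x y :=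
  (isChain_iff_pair_infix.1 hl.2 _ _ hxy).2

theorem IsComposite.col_lt {D : Diagram h} {l : List (Box h)} (hl : IsComposite D l) {x y : Box h}
    (hxy : [x, y] <:+: l) : col x < col y :=
  (isChain_iff_pair_infix.1 hl.2 _ _ hxy).1

theorem wellFounded_col_lt : WellFounded fun b b' : Box h => col b < col b' :=
  InvImage.wf col wellFounded_lt

theorem wellFounded_of_col_lt {T : Box h → Box h → Prop} (hT : ∀ x y, T x y → col x < col y) :
    WellFounded fun y x => T x y :=
  Subrelation.wf (fun {_ _} hxy => hT _ _ hxy) (InvImage.wf (r := (· > ·)) col wellFounded_gt)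

/-! ### The first rows -/

namespace Inv

variable (I : Inv D i)
include I

theorem row_iff {x y : Box h} (hl : Line D x y) : row x ≤ i ↔ row y ≤ i := by
  by_cases hr : i < row x ∨ i < row y
  · have h1 : Line (horizontalDiagram h) x y := by
      unfold Line
      rw [← I.horizontal x y hr]
      exact hl
    rw [(line_horizontal.1 h1).1]
  · omega

/-- The active line into the right end of a line starts at that line's left end, or it starts at
a lower potential. -/
theorem eq_or_pot_lt {x x' y : Box h} (hl : Line D x y) (hA : Active D x' y) :
    x' = x ∨ pot x' < pot x := by
  rcases hl.active_or_gated with h1 | h1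
  · exact Or.inl (I.injective _ _ _ hA h1)
  · obtain ⟨x'', h2, h3⟩ := I.gated _ _ h1
    rw [I.injective _ _ _ hA h2]
    exact Or.inr h3

theorem exists_active_left {x y : Box h} (hl : Line D x y) : ∃ x', Active D x' y := by
  obtain ⟨z, hz1, hz2⟩ := I.exists_left x y hl
  exact I.exists_pred y z hz1 hz2

theorem exists_active_right {x y : Box h} (hl : Line D x y) : ∃ y', Active D x y' := by
  obtain ⟨z, hz1, hz2⟩ := I.exists_right x y hl
  exact I.exists_succ x z hz1 hz2

omit I in
theorem exists_extreme_boxes {k : ℕ} (hk : 0 < k) (hk' : k ≤ height h) :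
    (∃ b : Box h, row b = k ∧ ∀ z : Box h, row z = row b → col b ≤ col z) ∧
      ∃ b : Box h, row b = k ∧ ∀ z : Box h, row z = row b → col z ≤ col b := by
  obtain ⟨v, hv⟩ : ∃ v, k ≤ h v := by
    by_contra! hlt
    exact absurd hk' (not_le.2 ((Finset.sup_lt_iff hk).2 fun v _ => hlt v))
  obtain ⟨b, -, hb⟩ := exists_box hk hv
  obtain ⟨x, hx, hx'⟩ := Set.exists_min_image {b : Box h | row b = k} col (Set.toFinite _) ⟨b, hb⟩
  obtain ⟨y, hy, hy'⟩ := Set.exists_max_image {b : Box h | row b = k} col (Set.toFinite _) ⟨b, hb⟩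
  exact ⟨⟨x, hx, fun z hz => hx' z (hz.trans hx)⟩, y, hy, fun z hz => hy' z (hz.trans hy)⟩

/-- The active lines of the first `i` rows form the only union of `i` disjoint composite lines
covering these rows.  The composite lines must end at the last boxes of the rows, so that every
other box of these rows has a successor, and `rel_of_potential` applies. -/
theorem rowsProperty (hi : i ≤ height h) : RowsProperty D i := by
  classical
  set T : Box h → Box h → Prop := fun x y => Active D x y ∧ row x ≤ i with hT
  have hfun : ∀ x y z, T x y → T x z → y = z := fun x y z h1 h2 => I.functional _ _ _ h1.1 h2.1
  have hinj : ∀ x y z, T x z → T y z → x = y := fun x y z h1 h2 => I.injective _ _ _ h1.1 h2.1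
  choose first hfirst hfirst' using fun k : Fin i =>
    (exists_extreme_boxes (h := h) (Nat.succ_pos k) (by omega)).1
  choose last hlast hlast' using fun k : Fin i =>
    (exists_extreme_boxes (h := h) (Nat.succ_pos k) (by omega)).2
  have first_inj : Function.Injective first := fun k m hkm => by
    have h1 := hfirst k
    rw [hkm, hfirst m] at h1
    exact Fin.ext (by omega)
  have last_inj : Function.Injective last := fun k m hkm => by
    have h1 := hlast k
    rw [hkm, hlast m] at h1
    exact Fin.ext (by omega)
  have no_pred : ∀ k x, ¬ Line D x (first k) := fun k x hl => by
    obtain ⟨z, hz1, hz2⟩ := I.exists_left _ _ hl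
    exact absurd (hfirst' k z hz1) (not_le.2 hz2)
  have no_succ : ∀ k x, ¬ Line D (last k) x := fun k x hl => by
    obtain ⟨z, hz1, hz2⟩ := I.exists_right _ _ hl
    exact absurd (hlast' k z hz1) (not_le.2 hz2)
  -- a box of the first rows without active predecessor is the first box of its row
  have eq_first : ∀ x : Box h, row x ≤ i → (∀ y, ¬ T y x) → ∃ k, first k = x := by
    intro x hx hno
    have hpos := row_pos x
    refine ⟨⟨row x - 1, by omega⟩, ?_⟩
    have hr := hfirst ⟨row x - 1, by omega⟩
    have hle := hfirst' ⟨row x - 1, by omega⟩ x (by rw [hr]; dsimp only; omega)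
    refine Box.ext_col_row (hle.antisymm ?_) (by rw [hr]; dsimp only; omega)
    by_contra! hlt
    obtain ⟨y, hy⟩ := I.exists_pred x _ (by rw [hr]; dsimp only; omega) hlt
    exact hno y ⟨hy, (I.row_iff hy.line).2 hx⟩
  choose path hhead hpath using fun x => exists_isPath (T := T)
    (wellFounded_of_col_lt fun x y hxy => I.col_lt _ _ hxy.1.line) x
  have hdisj : ∀ k m, k ≠ m → (path (first k)).Disjoint (path (first m)) := by
    intro k m hkm x hx1 hx2
    have h1 := head?_eq_of_mem_of_mem hinj (hpath (first k)).1 (hpath (first m)).1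
      (fun x hx y hy => by
        rw [hhead] at hx
        obtain rfl := Option.some.inj hx
        exact no_pred k y hy.1.line)
      (fun x hx y hy => by
        rw [hhead] at hx
        obtain rfl := Option.some.inj hx
        exact no_pred m y hy.1.line) hx1 hx2
    rw [hhead, hhead] at h1
    exact hkm (first_inj (Option.some.inj h1))
  have path_inj : Function.Injective fun k => path (first k) := by
    intro k m hkm
    have h1 := congrArg List.head? hkm
    dsimp only at h1
    rw [hhead, hhead] at h1
    exact first_inj (Option.some.inj h1)
  have hcard : (Finset.univ.image fun k => path (first k)).card = i := by
    rw [Finset.card_image_of_injective _ path_inj, Finset.card_univ, Fintype.card_fin]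
  refine ⟨Finset.univ.image fun k => path (first k), ⟨hcard, ?_, ?_, ?_⟩, ?_⟩
  · intro l hl
    obtain ⟨k, -, rfl⟩ := Finset.mem_image.1 hl
    refine ⟨fun hnil => ?_, (hpath _).1.imp fun x y hxy => ⟨I.col_lt _ _ hxy.1.line, hxy.1.line⟩⟩
    have := hhead (first k)
    simp [hnil] at this
  · intro l hl m hm hne
    obtain ⟨k, -, rfl⟩ := Finset.mem_image.1 hl
    obtain ⟨k', -, rfl⟩ := Finset.mem_image.1 hm
    exact hdisj k k' fun hk => hne (by rw [hk])
  · intro b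
    induction b using (wellFounded_col_lt (h := h)).induction with
    | _ b ih =>
      intro hb
      by_cases hp : ∃ y, T y b
      · obtain ⟨y, hy⟩ := hp
        obtain ⟨l, hl, hyl⟩ := ih y (I.col_lt _ _ hy.1.line) hy.2
        refine ⟨l, hl, ?_⟩
        obtain ⟨k, -, rfl⟩ := Finset.mem_image.1 hl
        exact (hpath _).mem_of_rel hfun hyl hy
      · push Not at hp
        obtain ⟨k, rfl⟩ := eq_first b hb hp
        exact ⟨_, Finset.mem_image_of_mem _ (Finset.mem_univ k),
          List.mem_of_mem_head? (hhead (first k))⟩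
  · rintro F ⟨hF, hcomp, hFd, hcov⟩
    have hn : ∀ l ∈ (F : Set (List (Box h))), l.Nodup := fun l hl => (hcomp l hl).nodup
    -- every member of `F` ends at the last box of a row
    have hends : ∀ l ∈ F, ∃ k, l.getLast? = some (last k) := by
      choose m hmF hm using fun k => hcov (last k) (by rw [hlast]; exact k.2)
      have hmlast : ∀ k, (m k).getLast? = some (last k) := by
        intro k
        by_contra hne
        obtain ⟨y, hy⟩ := exists_pair_infix_right (hm k) hne
        exact no_succ k y ((hcomp _ (hmF k)).line hy)
      have hm_inj : Function.Injective m := fun k k' hk => by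
        have h1 := hmlast k
        rw [hk, hmlast k'] at h1
        exact (last_inj (Option.some.inj h1)).symm
      have himg : Finset.univ.image m = F := Finset.eq_of_subset_of_card_le
        (Finset.image_subset_iff.2 fun k _ => hmF k)
        (by rw [Finset.card_image_of_injective _ hm_inj, Finset.card_univ, Fintype.card_fin, hF])
      intro l hl
      rw [← himg] at hl
      obtain ⟨k, -, rfl⟩ := Finset.mem_image.1 hl
      exact ⟨k, hmlast k⟩
    have hrow : ∀ l ∈ F, ∀ x ∈ l, row x ≤ i := by
      intro l hl
      obtain ⟨k, hk⟩ := hends l hl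
      exact forall_mem_of_getLast hk (by rw [hlast]; exact k.2)
        fun x y hxy => (I.row_iff ((hcomp l hl).line hxy)).2
    have hnext : ∀ x, (∃ y, T x y) → ∃ y, Consecutive (F : Set (List (Box h))) x y := by
      rintro x ⟨y, hy⟩
      obtain ⟨l, hl, hxl⟩ := hcov x hy.2
      obtain ⟨z, hz⟩ := exists_pair_infix_right hxl fun hx => by
        obtain ⟨k, hk⟩ := hends l hl
        rw [hk] at hx
        obtain rfl := Option.some.inj hx
        exact no_succ k y hy.1.line
      exact ⟨z, l, hl, hz⟩
    choose! g hg using hnext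
    have hgl : ∀ x, (∃ y, T x y) → Line D x (g x) ∧ row (g x) ≤ i := by
      intro x hx
      obtain ⟨l, hl, hxl⟩ := hg x hx
      exact ⟨(hcomp l hl).line hxl, hrow l hl _ (right_mem_of_pair_infix hxl)⟩
    have key : ∀ x ∈ Finset.univ.filter (fun x => ∃ y, T x y), T x (g x) := by
      refine rel_of_potential (pot := pot) hfun ?_ ?_ ?_
      · intro x hx
        obtain ⟨hl, hr⟩ := hgl x (Finset.mem_filter.1 hx).2
        obtain ⟨x', hx'⟩ := I.exists_active_left hl
        have : T x' (g x) := ⟨hx', (I.row_iff hx'.line).2 hr⟩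
        exact ⟨x', Finset.mem_filter.2 ⟨Finset.mem_univ _, _, this⟩, this⟩
      · intro x hx x' hx' he
        exact Consecutive.left_unique hn hFd (hg x (Finset.mem_filter.1 hx).2)
          (he ▸ hg x' (Finset.mem_filter.1 hx').2)
      · intro x hx x' hx'
        exact I.eq_or_pot_lt (hgl x (Finset.mem_filter.1 hx).2).1 hx'.1
    have key' : ∀ x y, T x y → Consecutive (F : Set (List (Box h))) x y := by
      intro x y hxy
      rw [hfun _ _ _ hxy (key x (Finset.mem_filter.2 ⟨Finset.mem_univ _, y, hxy⟩))]
      exact hg x ⟨y, hxy⟩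
    refine Finset.eq_of_subset_of_card_le (fun l hl => ?_) (by rw [hcard, hF])
    have hlT : IsPath T l := by
      refine ⟨isChain_iff_pair_infix.2 fun x y hxy => ?_, fun x hx y hy => ?_⟩
      · have hx := hrow l hl x (left_mem_of_pair_infix hxy)
        obtain ⟨z, hz⟩ := I.exists_active_right ((hcomp l hl).line hxy)
        rw [Consecutive.right_unique hn hFd ⟨l, hl, hxy⟩ (key' x z ⟨hz, hx⟩)]
        exact ⟨hz, hx⟩
      · obtain ⟨k, hk⟩ := hends l hl
        rw [hk] at hx
        obtain rfl := Option.some.inj hx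
        exact no_succ k y hy.1.line
    obtain ⟨a, ha⟩ : ∃ a, l.head? = some a := by
      cases l with
      | nil => exact absurd rfl (hcomp _ hl).1
      | cons a l => exact ⟨a, rfl⟩
    have hal := List.mem_of_mem_head? ha
    obtain ⟨k, hk⟩ := eq_first a (hrow l hl a hal) fun y hy => by
      obtain ⟨m, hm, hym⟩ := key' y a hy
      obtain rfl : l = m := by
        by_contra hne
        exact hFd l hl m hm hne hal (right_mem_of_pair_infix hym)
      exact head?_ne_of_pair_infix (hn l hl) hym ha
    rw [hlT.eq hfun (hpath (first k)) (by rw [hhead, ha, hk])]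
    exact Finset.mem_image_of_mem _ (Finset.mem_univ k)

end Inv

/-! ### Neighbouring columns -/

/-- Between neighbouring columns of height `i + 1`, all ungated lines of the first `i + 1` rows
end at the foot of the right one. -/
theorem eq_foot_of_zero (I : Inv D i) {C C' : Fin r} (hN : Neighbouring h (i + 1) C C')
    {x y : Box h} (hz : stage D i x y = Mark.zero) (hx : row x ≤ i + 1) (hC : C ≤ col x)
    (hC' : col y ≤ C') : col y = C' ∧ row y = i + 1 := by
  have hl : Line (stage D i) x y := by simp [Line, hz]
  have hy := (I.stage.row_iff hl).1 hx
  rcases I.ungated_stage ⟨hz, hx, hy⟩ with ⟨h1, h2⟩ | ⟨h1, h2, -⟩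
  · exact absurd ⟨h1, C, C', hN, hC, hC'⟩ h2
  · refine ⟨hC'.eq_of_not_lt fun hlt => ?_, h2⟩
    exact hN.2.2.2 _ (hC.trans_lt (I.stage.col_lt _ _ hl)) hlt h1

/-- The active line into the foot of the right one of two neighbouring columns is labelled `0`. -/
theorem zero_of_foot (I : Inv D i) {C C' : Fin r} (hN : Neighbouring h (i + 1) C C')
    {x y : Box h} (hA : Active (stage D i) x y) (hC : col y = C') (hy : row y = i + 1) :
    stage D i x y = Mark.zero := by
  have hT : ¬ ToGate D i x y := fun hT => by
    have := hT.1.2.2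
    omega
  have h1 : ¬ (JoinFirst D i x y ∨ JoinNext D i x y) := by
    rintro (⟨q, c, -, hG, -⟩ | ⟨p, q, c, c', -, -, hG, -⟩)
    · have := hG.1.2.2
      omega
    · have := hG.1.2.2
      omega
  rcases I.active_stage_iff.1 hA with hJ | ⟨hA, -, hR⟩
  · unfold stage
    rw [if_neg hT, if_neg (Inv.not_toRemove_of_join hJ), if_neg h1,
      if_pos (hJ.resolve_left (fun h => h1 (Or.inl h)) |>.resolve_left (fun h => h1 (Or.inr h))),
      if_pos (by rw [hC]; exact hN.2.2.1)]
  · have h0 : D x y = horizontalDiagram h x y := I.horizontal x y (Or.inr (by omega))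
    have ha : Adjacent x y := by
      rw [Active, h0] at hA
      exact active_horizontal.1 hA
    have hx : row x = i + 1 := ha.1.trans hy
    have h2 : h (col y) = i + 1 := by rw [hC]; exact hN.2.2.1
    have hz : D x y = Mark.zero := by
      rw [h0]
      unfold horizontalDiagram
      rw [if_pos ha, if_pos ⟨C, by rw [hx, hC]; exact hN⟩]
    unfold stage
    rw [if_neg hT, if_neg hR, if_neg h1, if_pos h2, hz, ite_self]

/-- The stages after the stage `i + 1` change the lines which start in the first `i + 1` rows
and lie between neighbouring columns of height `i + 1` only by gating some of them: an ungated line there ends in the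
right one of the two columns, hence it is the last line of any gap it lies in, and it can only be
rejoined to boxes further to the right. -/
theorem diagramAfter_eq_or_gated (h : Fin r → ℕ) {i t : ℕ} (ht : i + 1 ≤ t) {C C' : Fin r}
    (hN : Neighbouring h (i + 1) C C') {x y : Box h} (hx : row x ≤ i + 1) (hC : C ≤ col x)
    (hC' : col y ≤ C') :
    diagramAfter h t x y = diagramAfter h (i + 1) x y ∨
      diagramAfter h (i + 1) x y = Mark.zero ∧ diagramAfter h t x y = Mark.gated := by
  induction t, ht using Nat.le_induction generalizing x y with
  | base => exact Or.inl rfl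
  | succ t ht ih =>
    have I := inv_diagramAfter h t
    have foot : ∀ c', diagramAfter h t x c' = Mark.zero → col c' ≤ C' → col c' = C' := by
      intro c' hc' hle
      rcases ih hx hC hle with h1 | h1
      · rw [hc'] at h1
        exact (eq_foot_of_zero (inv_diagramAfter h i) hN h1.symm hx hC hle).1
      · rw [hc'] at h1
        exact absurd h1.2 (by simp)
    change stage (diagramAfter h t) t x y = _ ∨ _ ∧ stage (diagramAfter h t) t x y = _
    by_cases hT : ToGate (diagramAfter h t) t x y
    · right
      refine ⟨?_, by unfold stage; rw [if_pos hT]⟩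
      rcases ih hx hC hC' with h1 | h1
      · rw [← h1]
        exact hT.1.1
      · exact h1.1
    · have hR : ¬ ToRemove (diagramAfter h t) t x y := fun hR => by
        have := hR.1
        omega
      have h1 : ¬ JoinFirst (diagramAfter h t) t x y := by
        rintro ⟨q, c, hR, -⟩
        have := hR.1
        omega
      have h2 : ¬ JoinNext (diagramAfter h t) t x y := by
        rintro ⟨p, q, c, c', -, hG, hG', hle, -⟩
        have h3 := hle.trans_lt (I.col_lt_of_inGap hG')
        have h4 := foot c' hG.1.1 (h3.le.trans hC')
        exact absurd (h3.trans_le hC') (by rw [h4]; exact lt_irrefl _)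
      have h3 : ¬ JoinLast (diagramAfter h t) t x y := by
        rintro ⟨p, c', hR, hG, -⟩
        have h4 := foot c' hG.1.1 (hG.2.2.trans hC')
        have h5 : col y = C' := le_antisymm hC' (h4 ▸ hG.2.2)
        have h6 := row_le y
        rw [h5, hN.2.2.1, hR.row_right] at h6
        omega
      unfold stage
      rw [if_neg hT, if_neg hR, if_neg (by tauto), if_neg h3]
      exact ih hx hC hC'

/-- The active lines which lie in the first `s` rows and in the columns from `C` to `C'`. -/
def Inside (D : Diagram h) (s : ℕ) (C C' : Fin r) (x y : Box h) : Prop :=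
  Active D x y ∧ row x ≤ s ∧ C ≤ col x ∧ col y ≤ C'

namespace Inv

variable (I : Inv D i) {C C' : Fin r} (hN : Neighbouring h i C C')
include I

theorem inside_right_unique {s : ℕ} (x y z : Box h) (h1 : Inside D s C C' x y)
    (h2 : Inside D s C C' x z) : y = z :=
  I.functional _ _ _ h1.1 h2.1

theorem inside_left_unique {s : ℕ} (x y z : Box h) (h1 : Inside D s C C' x z)
    (h2 : Inside D s C C' y z) : x = y :=
  I.injective _ _ _ h1.1 h2.1

include hN

theorem exists_inside_right {x : Box h} (hx : row x ≤ i) (hC : C ≤ col x) (hC' : col x < C') :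
    ∃ y, Inside D i C C' x y := by
  obtain ⟨z, hz1, hz2⟩ := exists_box (row_pos x) (hN.2.2.1 ▸ hx : row x ≤ h C')
  obtain ⟨y, hy⟩ := I.exists_succ x z hz2 (hz1 ▸ hC')
  refine ⟨y, hy, hx, hC, ?_⟩
  by_contra! hlt
  exact absurd (I.height_lt _ _ hy.line hx _ hC' hlt) (by rw [hN.2.2.1]; exact lt_irrefl _)

theorem exists_inside_left {y : Box h} (hy : row y ≤ i) (hC : C < col y) (hC' : col y ≤ C') :
    ∃ x, Inside D i C C' x y := by
  obtain ⟨z, hz1, hz2⟩ := exists_box (row_pos y) (hN.2.1 ▸ hy : row y ≤ h C)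
  obtain ⟨x, hx⟩ := I.exists_pred y z hz2 (hz1 ▸ hC)
  have hxi := (I.row_iff hx.line).2 hy
  refine ⟨x, hx, hxi, ?_, hC'⟩
  by_contra! hlt
  exact absurd (I.height_lt _ _ hx.line hxi _ hlt hC) (by rw [hN.2.1]; exact lt_irrefl _)

/-- The active lines between two neighbouring columns of height `i` form disjoint composite lines
joining these columns and passing through all boxes of the first `i` rows between them. -/
theorem exists_inside_paths : ∃ F : Fin (h C) → List (Box h),
    (∀ k, (F k).head? = some ⟨C, k⟩ ∧ IsPath (Inside D i C C') (F k)) ∧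
    (∀ k m, k ≠ m → (F k).Disjoint (F m)) ∧
    (∃ σ : Fin (h C) ≃ Fin (h C'), ∀ k, (F k).getLast? = some ⟨C', σ k⟩) ∧
    ∀ b : Box h, row b ≤ i → C ≤ col b → col b ≤ C' → ∃ k, b ∈ F k := by
  choose F hhead hpath using fun k : Fin (h C) => exists_isPath (T := Inside D i C C')
    (wellFounded_of_col_lt fun x y hxy => I.col_lt _ _ hxy.1.line) ⟨C, k⟩
  have hdisj : ∀ k m, k ≠ m → (F k).Disjoint (F m) := by
    intro k m hkm x hx1 hx2
    have no_pred : ∀ k x, (F k).head? = some x → ∀ y, ¬ Inside D i C C' y x := by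
      intro k x hx y hy
      rw [hhead] at hx
      obtain rfl := Option.some.inj hx
      exact absurd (I.col_lt _ _ hy.1.line) (not_lt.2 hy.2.2.1)
    have h1 := head?_eq_of_mem_of_mem I.inside_left_unique (hpath k).1 (hpath m).1 (no_pred k)
      (no_pred m) hx1 hx2
    rw [hhead, hhead] at h1
    exact hkm (by simpa using h1)
  have hmem : ∀ k, ∀ x ∈ F k, row x ≤ i ∧ C ≤ col x ∧ col x ≤ C' := by
    intro k
    refine forall_mem_of_head (hhead k) ⟨?_, le_rfl, hN.1.le⟩ fun x y hxy hx => ?_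
    · exact (row_le _).trans hN.2.1.le
    · have h1 := isChain_iff_pair_infix.1 (hpath k).1 _ _ hxy
      exact ⟨(I.row_iff h1.1.line).1 h1.2.1, hx.2.1.trans (I.col_lt _ _ h1.1.line).le, h1.2.2.2⟩
  have hends : ∀ k, ∃ j : Fin (h C'), (F k).getLast? = some ⟨C', j⟩ := by
    intro k
    obtain ⟨b, hb⟩ : ∃ b, (F k).getLast? = some b := by
      have := hhead k
      cases hF : F k with
      | nil => simp [hF] at this
      | cons a l => exact ⟨_, List.getLast?_eq_some_getLast (by simp)⟩
    obtain ⟨h1, h2, h3⟩ := hmem k b (List.mem_of_getLast? hb)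
    have h4 : col b = C' := h3.eq_of_not_lt fun hlt => by
      obtain ⟨y, hy⟩ := I.exists_inside_right hN h1 h2 hlt
      exact (hpath k).2 b hb y hy
    obtain ⟨v, j⟩ := b
    obtain rfl : v = C' := h4
    exact ⟨j, hb⟩
  choose σ hσ using hends
  have hσinj : Function.Injective σ := by
    intro k m hkm
    by_contra hne
    exact hdisj k m hne (List.mem_of_getLast? (hσ k))
      (List.mem_of_getLast? (by rw [hσ m, hkm]))
  have hσbij : Function.Bijective σ :=
    (Fintype.bijective_iff_injective_and_card σ).2 ⟨hσinj, by simp [hN.2.1, hN.2.2.1]⟩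
  refine ⟨F, fun k => ⟨hhead k, hpath k⟩, hdisj, ⟨Equiv.ofBijective σ hσbij, fun k => hσ k⟩, ?_⟩
  intro b
  induction b using (wellFounded_col_lt (h := h)).induction with
  | _ b ih =>
    intro hb hC hC'
    rcases hC.lt_or_eq with hlt | rfl
    · obtain ⟨x, hx⟩ := I.exists_inside_left hN hb hlt hC'
      have hxb := I.col_lt _ _ hx.1.line
      obtain ⟨k, hk⟩ := ih x hxb hx.2.1 hx.2.2.1 (hxb.le.trans hC')
      exact ⟨k, (hpath k).mem_of_rel I.inside_right_unique hk hx⟩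
    · exact ⟨b.2, List.mem_of_mem_head? (hhead b.2)⟩

/-- Disjoint composite lines joining two neighbouring columns of height `i`, in a diagram `E`
whose lines starting in the first `i` rows between these columns are lines of `D`,
consist of active lines of `D`.  Boxes which are passed by are treated as fixed points in the
application of `rel_of_potential`. -/
theorem isPath_of_joinsColumns {E : Diagram h}
    (hE : ∀ x y, row x ≤ i → C ≤ col x → col y ≤ C' → Line E x y → Line D x y)
    {G : Fin (h C) → List (Box h)} (hG : JoinsColumns E C C' G) (k : Fin (h C)) :
    (G k).head? = some ⟨C, k⟩ ∧ IsPath (Inside D i C C') (G k) := by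
  classical
  obtain ⟨hcomp, hdisj, σ, hσ⟩ := hG
  have hn : ∀ l ∈ Set.range G, l.Nodup := by
    rintro _ ⟨k, rfl⟩
    exact (hcomp k).nodup
  have hd : ∀ l ∈ Set.range G, ∀ m ∈ Set.range G, l ≠ m → l.Disjoint m := by
    rintro _ ⟨k, rfl⟩ _ ⟨m, rfl⟩ hne
    exact hdisj k m fun hk => hne (by rw [hk])
  have hright : ∀ k, ∀ x ∈ G k, col x ≤ C' := fun k =>
    forall_mem_of_getLast (hσ k).2 le_rfl fun x y hxy hy => ((hcomp k).col_lt hxy).le.trans hy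
  have hleft : ∀ k, ∀ x ∈ G k, row x ≤ i ∧ C ≤ col x := by
    intro k
    refine forall_mem_of_head (hσ k).1 ⟨(row_le _).trans hN.2.1.le, le_rfl⟩ fun x y hxy hx => ?_
    have hl := hE x y hx.1 hx.2 (hright k y (right_mem_of_pair_infix hxy)) ((hcomp k).line hxy)
    exact ⟨(I.row_iff hl).1 hx.1, hx.2.trans ((hcomp k).col_lt hxy).le⟩
  have hline : ∀ x y, Consecutive (Set.range G) x y → Line D x y ∧ row y ≤ i ∧ col y ≤ C' := by
    rintro x y ⟨_, ⟨k, rfl⟩, hxy⟩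
    have h1 := hleft k x (left_mem_of_pair_infix hxy)
    have h2 := right_mem_of_pair_infix hxy
    exact ⟨hE x y h1.1 h1.2 (hright k y h2) ((hcomp k).line hxy), (hleft k y h2).1, hright k y h2⟩
  set g : Box h → Box h := fun x =>
    if hx : ∃ y, Consecutive (Set.range G) x y then hx.choose else x with hg
  have g_pos : ∀ x, (∃ y, Consecutive (Set.range G) x y) →
      Consecutive (Set.range G) x (g x) := by
    intro x hx
    simp only [hg, dif_pos hx]
    exact hx.choose_spec
  have g_neg : ∀ x, (¬ ∃ y, Consecutive (Set.range G) x y) → g x = x := by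
    intro x hx
    simp only [hg, dif_neg hx]
  -- a box to the left of `C'` without successor lies on no composite line
  have not_mem : ∀ x, col x < C' → (¬ ∃ y, Consecutive (Set.range G) x y) → ∀ k, x ∉ G k := by
    intro x hx hno k hk
    obtain ⟨y, hy⟩ := exists_pair_infix_right hk fun hlast => by
      rw [(hσ k).2] at hlast
      obtain rfl := Option.some.inj hlast
      exact lt_irrefl _ hx
    exact hno ⟨y, _, ⟨k, rfl⟩, hy⟩
  set L : Finset (Box h) := Finset.univ.filter fun x => row x ≤ i ∧ C ≤ col x ∧ col x < C' with hL
  have hmemL : ∀ x, x ∈ L ↔ row x ≤ i ∧ C ≤ col x ∧ col x < C' := fun x => by simp [hL]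
  have hgx : ∀ x ∈ L, row (g x) ≤ i ∧ C < col (g x) ∧ col (g x) ≤ C' := by
    intro x hx
    rw [hmemL] at hx
    by_cases hex : ∃ y, Consecutive (Set.range G) x y
    · obtain ⟨h1, h2, h3⟩ := hline _ _ (g_pos x hex)
      exact ⟨h2, hx.2.1.trans_lt (I.col_lt _ _ h1), h3⟩
    · rw [g_neg x hex]
      refine ⟨hx.1, hx.2.1.lt_of_ne ?_, hx.2.2.le⟩
      rintro rfl
      exact not_mem x hx.2.2 hex x.2 (List.mem_of_mem_head? (hσ x.2).1)
  have key : ∀ x ∈ L, Inside D i C C' x (g x) := by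
    refine rel_of_potential (pot := pot) I.inside_right_unique ?_ ?_ ?_
    · intro x hx
      obtain ⟨h1, h2, h3⟩ := hgx x hx
      obtain ⟨x', hx'⟩ := I.exists_inside_left hN h1 h2 h3
      exact ⟨x', (hmemL x').2 ⟨hx'.2.1, hx'.2.2.1, (I.col_lt _ _ hx'.1.line).trans_le h3⟩, hx'⟩
    · have mixed : ∀ x x', x ∈ L → (¬ ∃ y, Consecutive (Set.range G) x y) → g x = g x' →
          ¬ ∃ y, Consecutive (Set.range G) x' y := by
        intro x x' hx hex he hex'
        obtain ⟨_, ⟨m, rfl⟩, hm⟩ := g_pos x' hex'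
        rw [← he, g_neg x hex] at hm
        exact not_mem x ((hmemL x).1 hx).2.2 hex m (right_mem_of_pair_infix hm)
      intro x hx x' hx' he
      by_cases h1 : ∃ y, Consecutive (Set.range G) x y
      · have h2 := not_not.1 fun h2 => mixed x' x hx' h2 he.symm h1
        exact Consecutive.left_unique hn hd (g_pos x h1) (he ▸ g_pos x' h2)
      · have h2 := mixed x x' hx h1 he
        rwa [g_neg x h1, g_neg x' h2] at he
    · intro x hx x' hx'
      by_cases hex : ∃ y, Consecutive (Set.range G) x y
      · exact I.eq_or_pot_lt (hline _ _ (g_pos x hex)).1 hx'.1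
      · rw [g_neg x hex] at hx'
        exact Or.inr (pot_lt_of_col_lt (I.col_lt _ _ hx'.1.line))
  refine ⟨(hσ k).1, isChain_iff_pair_infix.2 fun x y hxy => ?_, fun x hx y hy => ?_⟩
  · have h1 := hleft k x (left_mem_of_pair_infix hxy)
    have h2 := ((hcomp k).col_lt hxy).trans_le (hright k y (right_mem_of_pair_infix hxy))
    have h3 : Consecutive (Set.range G) x y := ⟨_, ⟨k, rfl⟩, hxy⟩
    rw [Consecutive.right_unique hn hd h3 (g_pos x ⟨y, h3⟩)]
    exact key x ((hmemL x).2 ⟨h1.1, h1.2, h2⟩)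
  · rw [(hσ k).2] at hx
    obtain rfl := Option.some.inj hx
    exact absurd (I.col_lt _ _ hy.1.line) (not_lt.2 hy.2.2.2)

end Inv

/-- The composite lines joining neighbouring columns in the final diagram.  In a column of height `0`
there would be no line labelled `0`, whence the positivity of the heights. -/
theorem finalDiagram_joinsColumns (hpos : ∀ v, 0 < h v) {s : ℕ} {C C' : Fin r}
    (hN : Neighbouring h s C C') :
    ∃ F : Fin (h C) → List (Box h), JoinsColumns (finalDiagram h) C C' F ∧
      (∀ G, JoinsColumns (finalDiagram h) C C' G → G = F) ∧
      (∀ b : Box h, row b ≤ s → C ≤ col b → col b ≤ C' → ∃ k, b ∈ F k) ∧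
      ∃! e : Box h × Box h, (∃ k, [e.1, e.2] <:+: F k) ∧ ZeroLine (finalDiagram h) e.1 e.2 := by
  obtain ⟨i, rfl⟩ : ∃ i, s = i + 1 := ⟨s - 1, by have := hpos C; have := hN.2.1; omega⟩
  have ht : i + 1 ≤ height h := hN.2.1 ▸ Finset.le_sup (f := h) (Finset.mem_univ C)
  have I := inv_diagramAfter h (i + 1)
  have I0 := inv_diagramAfter h i
  have hwin : ∀ {x y : Box h}, row x ≤ i + 1 → C ≤ col x → col y ≤ C' → _ :=
    fun {x y} hx hC hC' => diagramAfter_eq_or_gated h ht hN (x := x) (y := y) hx hC hC'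
  obtain ⟨F, hF, hdisj, ⟨σ, hσ⟩, hcov⟩ := I.exists_inside_paths hN
  have hFin : ∀ {k x y}, [x, y] <:+: F k → Inside (diagramAfter h (i + 1)) (i + 1) C C' x y :=
    fun {k x y} hxy => isChain_iff_pair_infix.1 (hF k).2.1 _ _ hxy
  have hJ : JoinsColumns (finalDiagram h) C C' F := by
    refine ⟨fun k => ⟨fun hnil => ?_, isChain_iff_pair_infix.2 fun x y hxy => ?_⟩, hdisj, σ,
      fun k => ⟨(hF k).1, hσ k⟩⟩
    · have := (hF k).1
      simp [hnil] at this
    · have h1 := hFin hxy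
      refine ⟨I.col_lt _ _ h1.1.line, ?_⟩
      unfold Line finalDiagram
      rcases hwin h1.2.1 h1.2.2.1 h1.2.2.2 with h2 | h2
      · rw [h2]
        exact h1.1.line
      · rw [h2.2]
        simp
  refine ⟨F, hJ, fun G hG => funext fun k => ?_, hcov, ?_⟩
  · have hGk := I.isPath_of_joinsColumns hN (fun x y hx hC hC' hl => by
      unfold Line finalDiagram at hl
      unfold Line
      rcases hwin hx hC hC' with h2 | h2
      · rwa [← h2]
      · rw [h2.1]
        simp) hG k
    exact hGk.2.eq I.inside_right_unique (hF k).2 (hGk.1.trans (hF k).1.symm)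
  · obtain ⟨q, hq1, hq2⟩ := exists_box (h := h) (v := C') (Nat.succ_pos i) hN.2.2.1.ge
    obtain ⟨x, hx⟩ := I.exists_inside_left hN hq2.le (hq1 ▸ hN.1) hq1.le
    have hxq := I.col_lt _ _ hx.1.line
    refine ⟨(x, q), ⟨?_, ?_⟩, ?_⟩
    · obtain ⟨k, hk⟩ := hcov x hx.2.1 hx.2.2.1 (hxq.le.trans hq1.le)
      obtain ⟨y, hy⟩ := exists_pair_infix_right hk fun hlast => (hF k).2.2 x hlast q hx
      rw [I.inside_right_unique _ _ _ (hFin hy) hx] at hy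
      exact ⟨k, hy⟩
    · have hz : diagramAfter h (i + 1) x q = Mark.zero := zero_of_foot I0 hN hx.1 hq1 hq2
      unfold ZeroLine finalDiagram
      rcases hwin hx.2.1 hx.2.2.1 hx.2.2.2 with h2 | h2
      · exact Or.inl (h2.trans hz)
      · exact Or.inr h2.2
    · rintro ⟨a, b⟩ ⟨⟨k, hk⟩, hab⟩
      have h1 := hFin hk
      dsimp only at h1 hab
      have hz : diagramAfter h (i + 1) a b = Mark.zero := by
        rcases hwin h1.2.1 h1.2.2.1 h1.2.2.2 with h2 | h2
        · unfold ZeroLine finalDiagram at hab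
          rw [h2] at hab
          have := h1.1
          unfold Active at this
          grind
        · exact h2.1
      obtain ⟨h3, h4⟩ := eq_foot_of_zero I0 hN hz h1.2.1 h1.2.2.1 h1.2.2.2
      obtain rfl : b = q := Box.ext_col_row (h3.trans hq1.symm) (h4.trans hq2.symm)
      rw [I.injective _ _ _ h1.1 hx.1]

end ParabolicTableau

theorem proposition4p4p11 {n : ℕ} (c : Composition n) :
    (∀ i : ℕ, i ≤ ParabolicTableau.height c.blocksFun →
      ParabolicTableau.RowsProperty (ParabolicTableau.diagramAfter c.blocksFun i) i ∧
      ParabolicTableau.NonOverlapping (ParabolicTableau.diagramAfter c.blocksFun i) i) ∧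
    ParabolicTableau.PropertyOne (ParabolicTableau.finalDiagram c.blocksFun) ∧
    ParabolicTableau.PropertyTwo (ParabolicTableau.finalDiagram c.blocksFun) := by
  have hpos : ∀ v, 0 < c.blocksFun v := fun v => c.blocks_pos' v v.2
  refine ⟨fun i hi => ?_, fun s C C' hN => ?_, fun s C C' hN F hF => ?_⟩
  · have I := ParabolicTableau.inv_diagramAfter c.blocksFun i
    exact ⟨I.rowsProperty hi, I.nonOverlapping⟩
  · obtain ⟨F, h1, h2, h3, -⟩ := ParabolicTableau.finalDiagram_joinsColumns hpos hN
    exact ⟨F, h1, h2, h3⟩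
  · obtain ⟨F', -, h2, -, h4⟩ := ParabolicTableau.finalDiagram_joinsColumns hpos hN
    rw [h2 F hF]
    exact h4
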